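/- All rings are commutative and Noetherian and all schemes are locally Noetherian. A local ring is Gorenstein if it has finite injective dimension as a module over itself. If $A$ is a Cohen–Macaulay local ring of dimension $d$ with residue field $k$, a dualizing (canonical) module of $A$ is a finitely generated $A$-module $\omega$ with $\operatorname{Ext}^d_A(k,\omega)\cong k$ and $\operatorname{Ext}^i_A(k,\omega)=0$ for $i\neq d$. A scheme is locally Cohen–Macaulay (resp. locally Gorenstein) if all its local rings are Cohen–Macaulay (resp. Gorenstein), and equidimensional if all its irreducible components have the same dimension. A dualizing sheaf on a locally Cohen–Macaulay scheme $X$ is a coherent $\mathcal O_X$-module $\omega$ such that $\omega_x$ is a dualizing module of $\mathcal O_{X,x}$ for every $x\in X$. Let $X_1,X_2$ be equidimensional, locally Cohen–Macaulay schemes of the same dimension. A scheme $Y$ is called a linkage extension of $X_1$ and $X_2$ if there are closed immersions $j_i:X_i\to Y$, dualizing sheaves $\omega_i$ on $X_i$, invertible $\mathcal O_{X_i}$-modules $L_i$ ($i=1,2$), and short exact sequences of $\mathcal O_Y$-modules $$0\to (j_2)_*(\omega_2\otimes L_2)\to \mathcal O_Y\xrightarrow{\;p_1\;} (j_1)_*\mathcal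 O_{X_1}\to 0,$$ $$0\to (j_1)_*(\omega_1\otimes L_1)\to \mathcal O_Y\xrightarrow{\;p_2\;} (j_2)_*\mathcal O_{X_2}\to 0,$$ in which $p_1,p_2$ are the canonical homomorphisms attached to $j_1,j_2$. **Theorem.** Every linkage extension $Y$ of $X_1$ and $X_2$ is locally Gorenstein. -/

import Mathlib

open CategoryTheory AlgebraicGeometry TopologicalSpace MonoidalCategory

universe u

namespace LinkageExt

section LocalAlgebra

variable (R : Type u) [CommRing R] [IsLocalRing R]

/-- A Cohen–Macaulay local ring: a Noetherian local ring `R` whose maximal ideal contains an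
`R`-regular sequence of length `dim R`, i.e. `depth R = dim R`. -/
def IsCohenMacaulayLocal : Prop :=
  IsNoetherianRing R ∧
    ∃ rs : List R, (∀ r ∈ rs, r ∈ IsLocalRing.maximalIdeal R) ∧
      RingTheory.Sequence.IsRegular R rs ∧ ((rs.length : ℕ) : WithBot ℕ∞) = ringKrullDim R

/-- A Gorenstein local ring: a Noetherian local ring of finite injective dimension as a module
over itself. -/
def IsGorensteinLocal : Prop :=
  IsNoetherianRing R ∧ ∃ n : ℕ, HasInjectiveDimensionLE (ModuleCat.of R R) n

/-- A dualizing (or canonical) module of a Cohen–Macaulay local ring `R` of dimension `d` with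
residue field `k`: a finitely generated module `ω` such that `Ext^d(k, ω) ≅ k` and
`Ext^i(k, ω) = 0` for all `i ≠ d`. -/
def IsDualizingModule (ω : ModuleCat.{u} R) : Prop :=
  Module.Finite R ω ∧
    ∃ d : ℕ, ringKrullDim R = ((d : ℕ) : WithBot ℕ∞) ∧
      Nonempty (Abelian.Ext (ModuleCat.of R (IsLocalRing.ResidueField R)) ω d ≃ₗ[R]
        IsLocalRing.ResidueField R) ∧
      ∀ i : ℕ, i ≠ d →
        Subsingleton (Abelian.Ext (ModuleCat.of R (IsLocalRing.ResidueField R)) ω i)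

end LocalAlgebra

noncomputable section Sheaves

variable {X Y : Scheme.{u}}

/-- The structure sheaf `𝒪_X` as a module over itself. -/
def structureSheaf (X : Scheme.{u}) : X.Modules :=
  SheafOfModules.unit X.ringCatSheaf

/-- An `𝒪_X`-module as a presheaf of modules over the presheaf of commutative rings `𝒪_X`. -/
def toPresheafOfModules (M : X.Modules) :
    PresheafOfModules.{u} (X.presheaf ⋙ forget₂ CommRingCat RingCat) :=
  M.val

/-- The stalk `M_x` of an `𝒪_X`-module, as a module over the local ring `𝒪_{X,x}`. -/
def stalk (M : X.Modules) (x : X) : ModuleCat.{u} (X.presheaf.stalk x) :=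
  ModuleCat.of (X.presheaf.stalk x)
    ↑(TopCat.Presheaf.stalk (toPresheafOfModules M).presheaf x)

/-- The presheaf tensor product `U ↦ M(U) ⊗ N(U)`, taken over `𝒪_X(U)`. -/
def presheafTensor (M N : X.Modules) :
    PresheafOfModules.{u} (X.presheaf ⋙ forget₂ CommRingCat RingCat) :=
  toPresheafOfModules M ⊗ toPresheafOfModules N

/-- The tensor product `M ⊗ N` of `𝒪_X`-modules: the sheaf associated with `presheafTensor M N`. -/
def tensor (M N : X.Modules) : X.Modules :=
  (PresheafOfModules.sheafification (𝟙 X.ringCatSheaf.obj)).obj (presheafTensor M N)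

/-- The canonical morphism `𝒪_Y ⟶ j_* 𝒪_X` of `𝒪_Y`-modules attached to `j : X ⟶ Y`; on sections
over `U` it is the ring homomorphism `Γ(Y, U) ⟶ Γ(X, j⁻¹ U)`. -/
def structureMap (j : X ⟶ Y) :
    structureSheaf Y ⟶ (Scheme.Modules.pushforward j).obj (structureSheaf X) :=
  SheafOfModules.unitToPushforwardObjUnit j.toRingCatSheafHom

/-- An invertible `𝒪_X`-module: locally isomorphic to `𝒪_X`. -/
def IsInvertible (L : X.Modules) : Prop :=
  ∀ x : X, ∃ U : X.Opens, x ∈ U ∧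
    Nonempty (L.restrict U.ι ≅ structureSheaf (U : Scheme.{u}))

/-- A coherent module on a locally Noetherian scheme: quasi-coherent and of finite type. -/
def IsCoherent (M : X.Modules) : Prop :=
  SheafOfModules.IsQuasicoherent.{u} (R := X.ringCatSheaf) M ∧
    SheafOfModules.IsFiniteType.{u} (R := X.ringCatSheaf) M

/-- A dualizing sheaf on a locally Cohen–Macaulay scheme: a coherent module whose stalk at every
point `x` is a dualizing module of the local ring `𝒪_{X,x}`. -/
def IsDualizingSheaf (ω : X.Modules) : Prop :=
  IsCoherent ω ∧ ∀ x : X, IsDualizingModule (X.presheaf.stalk x) (stalk ω x)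

end Sheaves

/-- `X` is locally Noetherian and all its local rings are Cohen–Macaulay. -/
def IsLocallyCohenMacaulay (X : Scheme.{u}) : Prop :=
  IsLocallyNoetherian X ∧ ∀ x : X, IsCohenMacaulayLocal (X.presheaf.stalk x)

/-- `X` is locally Noetherian and all its local rings are Gorenstein. -/
def IsLocallyGorenstein (X : Scheme.{u}) : Prop :=
  IsLocallyNoetherian X ∧ ∀ x : X, IsGorensteinLocal (X.presheaf.stalk x)

/-- All irreducible components of `X` have the same dimension as `X`. -/
def IsEquidimensional (X : Scheme.{u}) : Prop :=
  ∀ Z ∈ irreducibleComponents X, topologicalKrullDim Z = topologicalKrullDim X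

/-- A double extension of closed subschemes `j₁ : X₁ ⟶ Y` and `j₂ : X₂ ⟶ Y` of `Y` by an
`𝒪_{X₁}`-module `F₁` and an `𝒪_{X₂}`-module `F₂`: short exact sequences of `𝒪_Y`-modules
`0 ⟶ F₂ ⟶ 𝒪_Y ⟶ 𝒪_{X₁} ⟶ 0` and `0 ⟶ F₁ ⟶ 𝒪_Y ⟶ 𝒪_{X₂} ⟶ 0`, the second map being the canonical
one. The `𝒪_Y`-linearity of `i₁` and `i₂` says `b • i₁ x = i₁ (p₁ b • x)` and
`b • i₂ x = i₂ (p₂ b • x)`. -/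
structure DoubleExtension {X₁ X₂ Y : Scheme.{u}} (j₁ : X₁ ⟶ Y) (j₂ : X₂ ⟶ Y)
    (F₁ : X₁.Modules) (F₂ : X₂.Modules) where
  isClosedImmersion₁ : IsClosedImmersion j₁
  isClosedImmersion₂ : IsClosedImmersion j₂
  i₂ : (Scheme.Modules.pushforward j₂).obj F₂ ⟶ structureSheaf Y
  zero₂ : i₂ ≫ structureMap j₁ = 0
  exact₂ : (ShortComplex.mk i₂ (structureMap j₁) zero₂).ShortExact
  i₁ : (Scheme.Modules.pushforward j₁).obj F₁ ⟶ structureSheaf Y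
  zero₁ : i₁ ≫ structureMap j₂ = 0
  exact₁ : (ShortComplex.mk i₁ (structureMap j₂) zero₁).ShortExact

/-- `Y` is a linkage extension of `X₁` and `X₂`: there is a double extension
`0 ⟶ ω₂ ⊗ L₂ ⟶ 𝒪_Y ⟶ 𝒪_{X₁} ⟶ 0`, `0 ⟶ ω₁ ⊗ L₁ ⟶ 𝒪_Y ⟶ 𝒪_{X₂} ⟶ 0` with `ωᵢ` a dualizing sheaf
and `Lᵢ` an invertible sheaf on `Xᵢ`. -/
def IsLinkageExtension (X₁ X₂ Y : Scheme.{u}) : Prop :=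
  ∃ (j₁ : X₁ ⟶ Y) (j₂ : X₂ ⟶ Y) (ω₁ L₁ : X₁.Modules) (ω₂ L₂ : X₂.Modules),
    IsDualizingSheaf ω₁ ∧ IsDualizingSheaf ω₂ ∧ IsInvertible L₁ ∧ IsInvertible L₂ ∧
      Nonempty (DoubleExtension j₁ j₂ (tensor ω₁ L₁) (tensor ω₂ L₂))

end LinkageExt

/-!
The statement is local, so fix a point `y` of `Y` and let `R = 𝒪_{Y,y}`.

If `y` lies on both subschemes, say with local rings `A₁` and `A₂`, then `R` surjects onto both, and
passing to stalks in the two exact sequences gives `0 → ω₂ → R → A₁ → 0` and `0 → ω₁ → R → A₂ → 0`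
with `ωᵢ` a dualizing module of `Aᵢ`: tensoring with an invertible module does not change stalks
(`exists_stalk_tensor_equiv`), and neither does pushing forward along a closed immersion
(`exists_pushforwardStalk_equiv`). That such a ring `R` is Gorenstein is the content of
`isGorensteinLocal_of_doubleExtension`. Both the `Aᵢ` and the `ωᵢ` have depth `dim Aᵢ`, so there is
a sequence `rs` in `R` of length `min (dim A₁) (dim A₂)` that is regular on `R`, on the `Aᵢ` and on
the `ωᵢ`. Reducing modulo `rs` keeps the two sequences exact. If the dimensions agree, `R/(rs)` is
Artinian. An element of its socle annihilates `ω₂/(rs)ω₂`, as that is contained in the maximal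
ideal. Since `ω₂/(rs)ω₂` is faithful over `A₂/(rs)`, the element lies in the kernel `ω₁/(rs)ω₁` of
`R/(rs) → A₂/(rs)`, whose socle is one-dimensional. A Noetherian local ring with such a reduction is
Gorenstein (`isGorensteinLocal_of_socle`). If the dimensions differed, `R` would be the sum of two
ideals contained in its maximal ideal (`false_of_subsingleton_ext_residueField`).

If `y` lies on one of the subschemes only, say on the first, then one sequence gives `R ≅ A₁` and
the other gives `ω₁ ≅ R`, so that `R` is a dualizing module of itself. Every point lies on one of
the subschemes, as otherwise both sequences would give `R = 0`.

Finite injective dimension is obtained from `Ext` groups in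
`hasInjectiveDimensionLE_of_ext_residueField`: a finitely generated module `M` over a Noetherian
local ring with residue field `k` has injective dimension at most `n` as soon as `Extⁱ(k, M) = 0`
for `i > n`.
-/

namespace LinkageExt

/-! ### Long exact sequences of `Ext` -/

section ExtModules

open Abelian

variable {R : Type u} [CommRing R]

/-- `Extⁱ_R(N, M)` for unbundled `R`-modules in the universe of `R`. -/
abbrev ExtMod (R : Type u) [CommRing R] (N M : Type u) [AddCommGroup N] [Module R N]
    [AddCommGroup M] [Module R M] (i : ℕ) : Type u :=
  Ext (ModuleCat.of R N) (ModuleCat.of R M) i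

variable {N' N N'' M' M M'' : Type u} [AddCommGroup N'] [Module R N'] [AddCommGroup N] [Module R N]
  [AddCommGroup N''] [Module R N''] [AddCommGroup M] [Module R M] [AddCommGroup M'] [Module R M']
  [AddCommGroup M''] [Module R M'']

/-- Functoriality of `Extⁱ` in the first variable. -/
noncomputable def extPre (f : N' →ₗ[R] N) (M : Type u) [AddCommGroup M] [Module R M] (i : ℕ) :
    ExtMod R N M i →ₗ[R] ExtMod R N' M i :=
  (Ext.mk₀ (ModuleCat.ofHom f)).precompOfLinear R (ModuleCat.of R M) (zero_add i)

/-- Functoriality of `Extⁱ` in the second variable. -/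
noncomputable def extPost (N : Type u) [AddCommGroup N] [Module R N] (f : M' →ₗ[R] M) (i : ℕ) :
    ExtMod R N M' i →ₗ[R] ExtMod R N M i :=
  (Ext.mk₀ (ModuleCat.ofHom f)).postcompOfLinear R (ModuleCat.of R N) (add_zero i)

lemma extPre_comp (f : N' →ₗ[R] N) (g : N →ₗ[R] N'') (i : ℕ) (x : ExtMod R N'' M i) :
    extPre f M i (extPre g M i x) = extPre (g ∘ₗ f) M i x := by
  simp [extPre, ModuleCat.ofHom_comp]

lemma extPre_smul_id (r : R) (i : ℕ) (x : ExtMod R N M i) :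
    extPre (r • LinearMap.id) M i x = r • x := by
  have : ModuleCat.ofHom (r • (LinearMap.id : N →ₗ[R] N)) = r • 𝟙 (ModuleCat.of R N) := rfl
  simp [extPre, this, Ext.mk₀_smul]

lemma extPost_smul_id (r : R) (i : ℕ) (x : ExtMod R N M i) :
    extPost N (r • LinearMap.id) i x = r • x := by
  have : ModuleCat.ofHom (r • (LinearMap.id : M →ₗ[R] M)) = r • 𝟙 (ModuleCat.of R M) := rfl
  simp [extPost, this, Ext.mk₀_smul]

lemma smul_ext_eq_zero_of_smul_eq_zero {r : R} (h : ∀ n : N, r • n = 0) {i : ℕ}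
    (x : ExtMod R N M i) : r • x = 0 := by
  have : (r • LinearMap.id : N →ₗ[R] N) = 0 := by ext n; simpa using h n
  rw [← extPre_smul_id, this]
  simp [extPre, ModuleCat.ofHom_zero]

noncomputable def extCongrLeft (e : N' ≃ₗ[R] N) (M : Type u) [AddCommGroup M] [Module R M] (i : ℕ) :
    ExtMod R N M i ≃ₗ[R] ExtMod R N' M i :=
  LinearEquiv.ofLinearMap (extPre e.toLinearMap M i) (extPre e.symm.toLinearMap M i)
    (by
      ext x
      have h := extPre_smul_id (N := N') (M := M) (1 : R) i x
      rw [one_smul, one_smul] at h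
      simpa [extPre_comp] using h)
    (by
      ext x
      have h := extPre_smul_id (N := N) (M := M) (1 : R) i x
      rw [one_smul, one_smul] at h
      simpa [extPre_comp] using h)

section Contravariant

variable {f : N' →ₗ[R] N} {g : N →ₗ[R] N''}

lemma extPre_exact (hf : Function.Injective f) (H : Function.Exact f g)
    (hg : Function.Surjective g) (M : Type u) [AddCommGroup M] [Module R M] (i : ℕ) :
    Function.Exact (extPre g M i) (extPre f M i) := by
  have hS := ModuleCat.shortComplex_shortExact
    (ModuleCat.shortComplexOfCompEqZero f g H.linearMap_comp_eq_zero) H hf hg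
  intro x
  constructor
  · intro hx
    obtain ⟨y, hy⟩ := Ext.contravariant_sequence_exact₂ hS _ x hx
    exact ⟨y, hy⟩
  · rintro ⟨y, rfl⟩
    rw [extPre_comp, H.linearMap_comp_eq_zero]
    simp [extPre, ModuleCat.ofHom_zero]

/-- The connecting maps of the long exact sequence of `Ext` in the first variable. -/
lemma exists_ext_connecting (hf : Function.Injective f) (H : Function.Exact f g)
    (hg : Function.Surjective g) (M : Type u) [AddCommGroup M] [Module R M] (i : ℕ) :
    ∃ δ : ExtMod R N' M i →ₗ[R] ExtMod R N'' M (i + 1),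
      Function.Exact (extPre f M i) δ ∧ Function.Exact δ (extPre g M (i + 1)) := by
  have hS := ModuleCat.shortComplex_shortExact
    (ModuleCat.shortComplexOfCompEqZero f g H.linearMap_comp_eq_zero) H hf hg
  refine ⟨hS.extClass.precompOfLinear R (ModuleCat.of R M) (add_comm 1 i), ?_, ?_⟩
  · intro x
    constructor
    · intro hx
      obtain ⟨y, hy⟩ := Ext.contravariant_sequence_exact₁ hS _ x (add_comm 1 i) hx
      exact ⟨y, hy⟩
    · rintro ⟨y, rfl⟩
      exact hS.extClass_comp_assoc y (h := add_comm 1 i)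
  · intro x
    constructor
    · intro hx
      obtain ⟨y, hy⟩ := Ext.contravariant_sequence_exact₃ hS _ x hx (add_comm 1 i)
      exact ⟨y, hy⟩
    · rintro ⟨y, rfl⟩
      exact hS.comp_extClass_assoc y (add_comm 1 i)

lemma subsingleton_ext_mid (hf : Function.Injective f) (H : Function.Exact f g)
    (hg : Function.Surjective g) {i : ℕ} (h' : Subsingleton (ExtMod R N' M i))
    (h'' : Subsingleton (ExtMod R N'' M i)) : Subsingleton (ExtMod R N M i) := by
  refine subsingleton_of_forall_eq 0 fun x ↦ ?_
  obtain ⟨y, rfl⟩ := (extPre_exact hf H hg M i x).1 (Subsingleton.elim _ _)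
  rw [Subsingleton.elim y 0, map_zero]

lemma subsingleton_ext_succ_right (hf : Function.Injective f) (H : Function.Exact f g)
    (hg : Function.Surjective g) {i : ℕ} (h' : Subsingleton (ExtMod R N' M i))
    (h : Subsingleton (ExtMod R N M (i + 1))) : Subsingleton (ExtMod R N'' M (i + 1)) := by
  obtain ⟨δ, -, h2⟩ := exists_ext_connecting hf H hg M i
  refine subsingleton_of_forall_eq 0 fun x ↦ ?_
  obtain ⟨y, rfl⟩ := (h2 x).1 (Subsingleton.elim _ _)
  rw [Subsingleton.elim y 0, map_zero]

end Contravariant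

section Covariant

variable {f : M' →ₗ[R] M} {g : M →ₗ[R] M''}

lemma extPost_exact (hf : Function.Injective f) (H : Function.Exact f g)
    (hg : Function.Surjective g) (N : Type u) [AddCommGroup N] [Module R N] (i : ℕ) :
    Function.Exact (extPost N f i) (extPost N g i) := by
  have hS := ModuleCat.shortComplex_shortExact
    (ModuleCat.shortComplexOfCompEqZero f g H.linearMap_comp_eq_zero) H hf hg
  intro x
  constructor
  · intro hx
    obtain ⟨y, hy⟩ := Ext.covariant_sequence_exact₂ _ hS x hx
    exact ⟨y, hy⟩
  · rintro ⟨y, rfl⟩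
    simp [extPost, ← ModuleCat.ofHom_comp, H.linearMap_comp_eq_zero, ModuleCat.ofHom_zero]

/-- The connecting maps of the long exact sequence of `Ext` in the second variable. -/
lemma exists_ext_connecting_post (hf : Function.Injective f) (H : Function.Exact f g)
    (hg : Function.Surjective g) (N : Type u) [AddCommGroup N] [Module R N] (i : ℕ) :
    ∃ δ : ExtMod R N M'' i →ₗ[R] ExtMod R N M' (i + 1),
      Function.Exact (extPost N g i) δ ∧ Function.Exact δ (extPost N f (i + 1)) := by
  have hS := ModuleCat.shortComplex_shortExact
    (ModuleCat.shortComplexOfCompEqZero f g H.linearMap_comp_eq_zero) H hf hg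
  refine ⟨hS.extClass.postcompOfLinear R (ModuleCat.of R N) rfl, ?_, ?_⟩
  · intro x
    constructor
    · intro hx
      obtain ⟨y, hy⟩ := Ext.covariant_sequence_exact₃ _ hS x rfl hx
      exact ⟨y, hy⟩
    · rintro ⟨y, rfl⟩
      have : (Ext.mk₀ (ModuleCat.ofHom g)).comp hS.extClass (zero_add 1) = 0 := hS.comp_extClass
      simp [extPost, this]
  · intro x
    constructor
    · intro hx
      obtain ⟨y, hy⟩ := Ext.covariant_sequence_exact₁ _ hS x hx rfl
      exact ⟨y, hy⟩
    · rintro ⟨y, rfl⟩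
      have : hS.extClass.comp (Ext.mk₀ (ModuleCat.ofHom f)) (add_zero 1) = 0 := hS.extClass_comp
      simp [extPost, this]

lemma subsingleton_ext_post_mid (hf : Function.Injective f) (H : Function.Exact f g)
    (hg : Function.Surjective g) {i : ℕ} (h' : Subsingleton (ExtMod R N M' i))
    (h'' : Subsingleton (ExtMod R N M'' i)) : Subsingleton (ExtMod R N M i) := by
  refine subsingleton_of_forall_eq 0 fun x ↦ ?_
  obtain ⟨y, rfl⟩ := (extPost_exact hf H hg N i x).1 (Subsingleton.elim _ _)
  rw [Subsingleton.elim y 0, map_zero]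

end Covariant

/-- `Ext⁰ = Hom`. -/
noncomputable def extZero (R : Type u) [CommRing R] (N M : Type u) [AddCommGroup N] [Module R N]
    [AddCommGroup M] [Module R M] : ExtMod R N M 0 ≃ₗ[R] (N →ₗ[R] M) :=
  (Ext.linearEquiv₀ (R := R)).trans ModuleCat.homLinearEquiv

end ExtModules

/-! ### Injective dimension and `Ext` from the residue field -/

section InjectiveDimension

variable {R : Type u} [CommRing R]

/-- The criterion of Baer for injective dimension: it is enough to test `Extⁿ⁺¹` on cyclic modules.
The induction embeds `M` into an injective module and passes to the cokernel. -/
lemma hasInjectiveDimensionLE_of_ext_quotient (n : ℕ) (M : Type u) [AddCommGroup M] [Module R M]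
    (h : ∀ I : Ideal R, Subsingleton (ExtMod R (R ⧸ I) M (n + 1))) :
    HasInjectiveDimensionLE (ModuleCat.of R M) n := by
  induction n generalizing M with
  | zero =>
    change HasInjectiveDimensionLT _ (0 + 1)
    rw [zero_add, ← injective_iff_hasInjectiveDimensionLT_one,
      ← Module.injective_iff_injective_object]
    apply Module.Baer.injective
    intro I g
    obtain ⟨δ, h1, -⟩ := exists_ext_connecting (f := I.subtype) (g := I.mkQ)
      I.injective_subtype (LinearMap.exact_subtype_mkQ I) (Submodule.mkQ_surjective I) M 0
    obtain ⟨y, hy⟩ := (h1 ((extZero R I M).symm g)).1 ((h I).elim _ _)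
    refine ⟨extZero R R M y, fun x hx ↦ ?_⟩
    obtain ⟨z, rfl⟩ := (extZero R R M).symm.surjective y
    have : (extPre I.subtype M 0) ((extZero R R M).symm z) =
        (extZero R I M).symm (z ∘ₗ I.subtype) := by
      simp only [extPre, extZero, LinearEquiv.trans_symm, LinearEquiv.trans_apply]
      exact Abelian.Ext.mk₀_comp_mk₀ _ _
    rw [this] at hy
    have := (extZero R I M).symm.injective hy
    rw [LinearEquiv.apply_symm_apply, ← this]
    rfl
  | succ n ih =>
    let E : ModuleCat.{u} R := Injective.under (ModuleCat.of R M)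
    have hE : Injective (ModuleCat.of R E) :=
      Injective.injective_under (ModuleCat.of R M)
    let f : M →ₗ[R] E := (Injective.ι (ModuleCat.of R M)).hom
    have hf : Function.Injective f :=
      (ModuleCat.mono_iff_injective (Injective.ι (ModuleCat.of R M))).1 inferInstance
    have hS := ModuleCat.shortComplex_shortExact
      (ModuleCat.shortComplexOfCompEqZero f (LinearMap.range f).mkQ
        f.exact_map_mkQ_range.linearMap_comp_eq_zero) f.exact_map_mkQ_range hf
        (Submodule.mkQ_surjective _)
    refine (hS.hasInjectiveDimensionLT_X₃_iff n hE).1 (ih _ fun I ↦ ?_)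
    obtain ⟨δ, h1, -⟩ := exists_ext_connecting_post hf f.exact_map_mkQ_range
      (Submodule.mkQ_surjective _) (R ⧸ I) (n + 1)
    refine subsingleton_of_forall_eq 0 fun x ↦ ?_
    obtain ⟨y, rfl⟩ := (h1 x).1 ((h I).elim _ _)
    have hy : y = 0 := Abelian.Ext.eq_zero_of_injective _
    rw [hy, map_zero]

lemma isFiniteLength_of_ideal_smul_eq_zero [IsNoetherianRing R] (I : Ideal R)
    [IsArtinianRing (R ⧸ I)] {N : Type*} [AddCommGroup N] [Module R N] [Module.Finite R N]
    (h : ∀ x ∈ I, ∀ y : N, x • y = 0) :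
    IsFiniteLength R N := by
  let _ : Module (R ⧸ I) N := Module.IsTorsionBySet.module (I := I) fun y x ↦ h x x.2 y
  have : IsScalarTower R (R ⧸ I) N :=
    Module.IsTorsionBySet.isScalarTower (I := I) fun y x ↦ h x x.2 y
  have : Module.Finite (R ⧸ I) N := Module.Finite.of_restrictScalars_finite R _ _
  have hsurj : Function.Surjective (algebraMap R (R ⧸ I)) := Ideal.Quotient.mk_surjective
  refine isFiniteLength_iff_isNoetherian_isArtinian.2 ⟨?_, ?_⟩
  · exact isNoetherian_of_isNoetherianRing_of_finite R N
  · exact isArtinian_of_surjective_algebraMap hsurj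

lemma isFiniteLength_quotient_of_isArtinianRing [IsNoetherianRing R] (I : Ideal R)
    [IsArtinianRing (R ⧸ I)] : IsFiniteLength R (R ⧸ I) :=
  isFiniteLength_of_ideal_smul_eq_zero I fun x hx y ↦ by
    obtain ⟨y, rfl⟩ := Ideal.Quotient.mk_surjective y
    exact Ideal.Quotient.eq_zero_iff_mem.2 (Ideal.mul_mem_right _ _ hx)

end InjectiveDimension

section Bass

variable {R : Type u} [CommRing R] [IsLocalRing R] [IsNoetherianRing R]

open IsLocalRing

lemma subsingleton_ext_of_subsingleton {R : Type u} [CommRing R] (N M : Type u) [AddCommGroup N]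
    [Module R N] [AddCommGroup M] [Module R M] [Subsingleton N] (i : ℕ) :
    Subsingleton (ExtMod R N M i) := by
  have : Limits.IsZero (ModuleCat.of R N) := ModuleCat.isZero_of_subsingleton (ModuleCat.of R N)
  refine subsingleton_of_forall_eq 0 fun x ↦ ?_
  rw [← x.mk₀_id_comp, this.eq_zero_of_src (𝟙 _), Abelian.Ext.mk₀_zero, Abelian.Ext.zero_comp]

lemma subsingleton_ext_of_isFiniteLength {R : Type u} [CommRing R] [IsLocalRing R] {M : Type u}
    [AddCommGroup M] [Module R M] {i : ℕ} (h : Subsingleton (ExtMod R (ResidueField R) M i))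
    {N : Type u} [AddCommGroup N] [Module R N]
    (hN : IsFiniteLength R N) : Subsingleton (ExtMod R N M i) := by
  induction hN with
  | @of_subsingleton N _ _ _ =>
    exact subsingleton_ext_of_subsingleton N M i
  | @of_simple_quotient N _ _ S hS _ ih =>
    obtain ⟨I, hI, ⟨e⟩⟩ := isSimpleModule_iff_quot_maximal.1 hS
    obtain rfl := IsLocalRing.eq_maximalIdeal hI
    exact subsingleton_ext_mid S.injective_subtype (LinearMap.exact_subtype_mkQ S)
      (Submodule.mkQ_surjective S) ih
      (@Equiv.subsingleton _ _ (extCongrLeft e M i).symm.toEquiv h)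

lemma isArtinianRing_quotient_of_pow_le {I : Ideal R} {n : ℕ} (h : maximalIdeal R ^ n ≤ I) :
    IsArtinianRing (R ⧸ I) := by
  by_cases hI : I = ⊤
  · have : Subsingleton (R ⧸ I) := Ideal.Quotient.subsingleton_iff.2 hI
    infer_instance
  · refine quotient_artinian_of_mem_minimalPrimes_of_isLocalRing I
      ⟨⟨inferInstance, le_maximalIdeal hI⟩, fun q hq _ ↦ ?_⟩
    have := hq.1
    exact Ideal.IsPrime.le_of_pow_le (h.trans hq.2)

lemma isFiniteLength_of_pow_smul_eq_zero {N : Type*} [AddCommGroup N] [Module R N]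
    [Module.Finite R N] (n : ℕ) (h : ∀ x ∈ maximalIdeal R ^ n, ∀ y : N, x • y = 0) :
    IsFiniteLength R N := by
  have : IsArtinianRing (R ⧸ maximalIdeal R ^ n) :=
    isArtinianRing_quotient_of_pow_le le_rfl
  exact isFiniteLength_of_ideal_smul_eq_zero (maximalIdeal R ^ n) h

/-- The vanishing of `Extⁱ(k, M)` for `i > n` propagates to all finitely generated modules `N`. The
proof is a Noetherian induction on an ideal `I` killing `N`, started with `I` containing the maximal
ideal. For `x` in the maximal ideal and not in `I`, the kernel and the cokernel of multiplication by
`x` on `N` are killed by the larger ideal `I + (x)`, so `x` acts surjectively on `Extⁱ(N, M)`, which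
vanishes by the lemma of Nakayama. -/
lemma subsingleton_ext_of_ideal_smul_eq_zero {M : Type u} [AddCommGroup M] [Module R M]
    [Module.Finite R M] {n : ℕ} (h : ∀ i > n, Subsingleton (ExtMod R (ResidueField R) M i))
    (I : Ideal R) (N : Type u) [AddCommGroup N] [Module R N] [Module.Finite R N]
    (hI : ∀ x ∈ I, ∀ y : N, x • y = 0) : ∀ i > n, Subsingleton (ExtMod R N M i) := by
  induction I using WellFoundedGT.induction generalizing N with
  | ind I ih =>
    by_cases hm : maximalIdeal R ≤ I
    · intro i hi
      exact subsingleton_ext_of_isFiniteLength (h i hi) (isFiniteLength_of_pow_smul_eq_zero 1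
        fun x hx ↦ hI x (hm (by simpa using hx)))
    · obtain ⟨x, hxm, hxI⟩ := SetLike.not_le_iff_exists.1 hm
      have hlt : I < I ⊔ Ideal.span {x} := left_lt_sup.2 (by simpa using hxI)
      intro i hi
      let f : N →ₗ[R] N := x • LinearMap.id
      have key (P : Type u) [AddCommGroup P] [Module R P] (h1 : ∀ a ∈ I, ∀ y : P, a • y = 0)
          (h2 : ∀ y : P, x • y = 0) (a : R) (ha : a ∈ I ⊔ Ideal.span {x}) (y : P) : a • y = 0 := by
        obtain ⟨b, hb, c, hc, rfl⟩ := Submodule.mem_sup.1 ha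
        obtain ⟨c, rfl⟩ := Ideal.mem_span_singleton'.1 hc
        rw [add_smul, h1 b hb, mul_smul, h2, smul_zero, add_zero]
      have hK := ih _ hlt (LinearMap.ker f) (key _ (fun a ha y ↦ Subtype.ext (hI a ha y))
        (fun y ↦ Subtype.ext y.2)) i hi
      have hC := ih _ hlt (N ⧸ LinearMap.range f) (key _
        (fun a ha y ↦ by
          obtain ⟨y, rfl⟩ := Submodule.mkQ_surjective _ y
          rw [← map_smul, hI a ha, map_zero])
        (fun y ↦ by
          obtain ⟨y, rfl⟩ := Submodule.mkQ_surjective _ y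
          rw [← map_smul]
          exact (Submodule.Quotient.mk_eq_zero _).2 ⟨y, rfl⟩)) (i + 1) (by omega)
      -- multiplication by `x` factors as `N → xN → N`; both maps are surjective on `Extⁱ(-, M)`
      have hs1 : Function.Surjective (extPre (LinearMap.range f).subtype M i) := by
        obtain ⟨δ, h1, -⟩ := exists_ext_connecting (LinearMap.range f).injective_subtype
          (LinearMap.exact_subtype_mkQ _) (Submodule.mkQ_surjective _) M i
        exact fun y ↦ (h1 y).1 (Subsingleton.elim _ _)
      have hs2 : Function.Surjective (extPre f.rangeRestrict M i) := by
        have h1 := extPre_exact (f := (LinearMap.ker f).subtype) (g := f.rangeRestrict)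
          (LinearMap.ker f).injective_subtype
          (fun y ↦ by simp [Subtype.ext_iff]) f.surjective_rangeRestrict M i
        exact fun y ↦ (h1 y).1 (Subsingleton.elim _ _)
      have hs : ∀ y : ExtMod R N M i, ∃ z : ExtMod R N M i, x • z = y := by
        intro y
        obtain ⟨y, rfl⟩ := hs2 y
        obtain ⟨z, rfl⟩ := hs1 y
        refine ⟨z, ?_⟩
        rw [extPre_comp, ← extPre_smul_id]
        rfl
      by_contra hns
      rw [not_subsingleton_iff_nontrivial] at hns
      have htop : (⊤ : Submodule R (ExtMod R N M i)) ≤ maximalIdeal R • ⊤ := by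
        intro y _
        obtain ⟨z, rfl⟩ := hs y
        exact Submodule.smul_mem_smul hxm trivial
      have := Submodule.eq_bot_of_le_smul_of_le_jacobson_bot _ _ Module.Finite.fg_top htop
        (IsLocalRing.maximalIdeal_le_jacobson _)
      exact bot_ne_top this.symm

/-- A finitely generated module `M` over a Noetherian local ring with `Extⁱ(k, M) = 0` for `i > n`
has injective dimension at most `n`. -/
theorem hasInjectiveDimensionLE_of_ext_residueField {M : Type u} [AddCommGroup M] [Module R M]
    [Module.Finite R M] {n : ℕ} (h : ∀ i > n, Subsingleton (ExtMod R (ResidueField R) M i)) :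
    HasInjectiveDimensionLE (ModuleCat.of R M) n :=
  hasInjectiveDimensionLE_of_ext_quotient n M fun I ↦
    subsingleton_ext_of_ideal_smul_eq_zero h ⊥ (R ⧸ I) (by simp) (n + 1) (by omega)

end Bass

/-! ### Regular sequences, `Ext` and length -/

section RegularSequences

variable {R : Type u} [CommRing R]

open RingTheory.Sequence Pointwise

/-- For `x` regular on `M` and zero on `N`, the connecting map `Extⁱ(N, M/xM) → Extⁱ⁺¹(N, M)` is
surjective, and bijective if `Extⁱ(N, M) = 0`. -/
lemma exists_ext_quotSMulTop {M N : Type u} [AddCommGroup M] [Module R M] [AddCommGroup N]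
    [Module R N] {x : R} (hx : IsSMulRegular M x) (hN : ∀ n : N, x • n = 0) (i : ℕ) :
    ∃ δ : ExtMod R N (QuotSMulTop x M) i →ₗ[R] ExtMod R N M (i + 1),
      Function.Surjective δ ∧ (Subsingleton (ExtMod R N M i) → Function.Injective δ) := by
  obtain ⟨δ, h1, h2⟩ := exists_ext_connecting_post (f := LinearMap.lsmul R M x)
    (g := (x • (⊤ : Submodule R M)).mkQ) hx (LinearMap.exact_lsmul_mkQ_smul_top M x)
    (Submodule.mkQ_surjective _) N i
  refine ⟨δ, fun y ↦ (h2 y).1 ?_, fun h ↦ ?_⟩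
  · exact (extPost_smul_id x (i + 1) y).trans (smul_ext_eq_zero_of_smul_eq_zero hN y)
  · refine (injective_iff_map_eq_zero δ).2 fun y hy ↦ ?_
    obtain ⟨z, rfl⟩ := (h1 y).1 hy
    rw [Subsingleton.elim z 0, map_zero]

lemma subsingleton_ext_zero_of_isSMulRegular {M N : Type u} [AddCommGroup M] [Module R M]
    [AddCommGroup N] [Module R N] {x : R} (hx : IsSMulRegular M x) (hN : ∀ n : N, x • n = 0) :
    Subsingleton (ExtMod R N M 0) := by
  have : Subsingleton (N →ₗ[R] M) := subsingleton_of_forall_eq 0 fun f ↦ by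
    ext n
    exact hx (by simp only [← map_smul, hN, map_zero, LinearMap.zero_apply, smul_zero])
  exact (extZero R N M).toEquiv.subsingleton

/-- If a weakly regular sequence `rs` on `M` kills `N`, then `Extⁱ(N, M)` vanishes for `i < |rs|`,
and it is `Hom(N, M/(rs)M)` for `i = |rs|`. -/
lemma ext_of_isWeaklyRegular {M N : Type u} [AddCommGroup M] [Module R M] [AddCommGroup N]
    [Module R N] {rs : List R} (hrs : IsWeaklyRegular M rs) (hN : ∀ r ∈ rs, ∀ n : N, r • n = 0) :
    (∀ i < rs.length, Subsingleton (ExtMod R N M i)) ∧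
      Nonempty (ExtMod R N M rs.length ≃ₗ[R]
        (N →ₗ[R] M ⧸ Ideal.ofList rs • (⊤ : Submodule R M))) := by
  induction rs generalizing M with
  | nil =>
    refine ⟨by simp, ⟨(extZero R N M).trans (LinearEquiv.congrRight ?_)⟩⟩
    exact (Submodule.quotEquivOfEqBot _ (by simp)).symm
  | cons x rs ih =>
    obtain ⟨hx, hrs⟩ := (isWeaklyRegular_cons_iff M x rs).1 hrs
    have hxN := hN x (by simp)
    obtain ⟨h1, ⟨e⟩⟩ := ih hrs fun r hr ↦ hN r (by simp [hr])
    have hv : ∀ i < (x :: rs).length, Subsingleton (ExtMod R N M i) := by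
      rintro (_ | i) hi
      · exact subsingleton_ext_zero_of_isSMulRegular hx hxN
      · obtain ⟨δ, hδ, -⟩ := exists_ext_quotSMulTop (N := N) hx hxN i
        have := h1 i (by simpa using hi)
        exact hδ.subsingleton
    refine ⟨hv, ?_⟩
    obtain ⟨δ, hδ, hδ'⟩ := exists_ext_quotSMulTop (N := N) hx hxN rs.length
    have e' := LinearEquiv.ofBijective δ ⟨hδ' (hv _ (by simp)), hδ⟩
    exact ⟨(e'.symm.trans e).trans (LinearEquiv.congrRight
      (Submodule.quotOfListConsSMulTopEquivQuotSMulTopInner M x rs).symm)⟩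

/-- Reduction modulo a sequence that is regular on `M''` keeps `M' → M` injective. -/
lemma mem_ofList_smul_of_map_mem {M' M M'' : Type*} [AddCommGroup M'] [Module R M']
    [AddCommGroup M] [Module R M] [AddCommGroup M''] [Module R M''] {f : M' →ₗ[R] M}
    {g : M →ₗ[R] M''} (hf : Function.Injective f) (H : Function.Exact f g)
    (hg : Function.Surjective g) {rs : List R} (hrs : IsWeaklyRegular M'' rs) {x : M'}
    (hx : f x ∈ Ideal.ofList rs • (⊤ : Submodule R M)) :
    x ∈ Ideal.ofList rs • (⊤ : Submodule R M') := by
  have h0 : Function.Exact (0 : M' →ₗ[R] M') f := fun y ↦ by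
    rw [map_eq_zero_iff f hf]
    exact ⟨fun h ↦ ⟨0, h.symm⟩, fun ⟨_, h⟩ ↦ h.symm⟩
  have := map_first_exact_on_four_term_right_exact_of_isSMulRegular_last h0 H hg hrs
  obtain ⟨y, hy⟩ := (this (Submodule.Quotient.mk x)).1 (by
    rw [Submodule.mapQ_apply]
    exact (Submodule.Quotient.mk_eq_zero _).2 hx)
  obtain ⟨y, rfl⟩ := Submodule.Quotient.mk_surjective _ y
  rw [Submodule.mapQ_apply, LinearMap.zero_apply, Submodule.Quotient.mk_zero] at hy
  exact (Submodule.Quotient.mk_eq_zero _).1 hy.symm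

/-- A direct summand inherits weakly regular sequences. -/
lemma isWeaklyRegular_of_retract {M N : Type*} [AddCommGroup M] [Module R M] [AddCommGroup N]
    [Module R N] {rs : List R} (h : IsWeaklyRegular M rs) (s : N →ₗ[R] M) (p : M →ₗ[R] N)
    (hps : p ∘ₗ s = LinearMap.id) : IsWeaklyRegular N rs := by
  constructor
  intro i hi
  let I := Ideal.ofList (rs.take i)
  have hs : I • (⊤ : Submodule R N) ≤ (I • (⊤ : Submodule R M)).comap s := by
    rw [← Submodule.map_le_iff_le_comap, Submodule.map_smul'']
    exact Submodule.smul_mono le_rfl le_top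
  have hp : I • (⊤ : Submodule R M) ≤ (I • (⊤ : Submodule R N)).comap p := by
    rw [← Submodule.map_le_iff_le_comap, Submodule.map_smul'']
    exact Submodule.smul_mono le_rfl le_top
  refine IsSMulRegular.of_injective (Submodule.mapQ _ _ s hs) ?_ (h.regular_mod_prev i hi)
  refine Function.LeftInverse.injective (g := Submodule.mapQ _ _ p hp) fun x ↦ ?_
  obtain ⟨x, rfl⟩ := Submodule.Quotient.mk_surjective _ x
  rw [Submodule.mapQ_apply, Submodule.mapQ_apply, ← LinearMap.comp_apply, hps]
  rfl

/-- `Hom(R/J, Q) = Q` if `J` kills `Q`. -/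
noncomputable def homQuotientEquiv (J : Ideal R) (Q : Type*) [AddCommGroup Q] [Module R Q]
    (h : ∀ a ∈ J, ∀ q : Q, a • q = 0) : ((R ⧸ J) →ₗ[R] Q) ≃ₗ[R] Q :=
  LinearEquiv.ofBijective
    { toFun f := f 1
      map_add' _ _ := rfl
      map_smul' _ _ := rfl }
    ⟨fun f g hfg ↦ by
      ext
      simpa using hfg,
    fun q ↦ ⟨Submodule.liftQ J (LinearMap.toSpanSingleton R Q q) fun a ha ↦ h a ha q,
      one_smul R q⟩⟩

end RegularSequences

section Length

variable {R : Type u} [CommRing R] [IsLocalRing R]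

open IsLocalRing

variable {M : Type u} [AddCommGroup M] [Module R M] {n : ℕ}

lemma length_le_add_of_exact {R A B C : Type*} [CommRing R] [AddCommGroup A] [Module R A]
    [AddCommGroup B] [Module R B] [AddCommGroup C] [Module R C] {f : A →ₗ[R] B} {g : B →ₗ[R] C}
    (h : Function.Exact f g) :
    Module.length R B ≤ Module.length R A + Module.length R C := by
  rw [Module.length_eq_add_of_exact (LinearMap.range f).subtype g.rangeRestrict
    (Submodule.injective_subtype _) g.surjective_rangeRestrict
    (fun x ↦ by simpa [Subtype.ext_iff] using h x)]
  exact add_le_add (Module.length_le_of_surjective f.rangeRestrict f.surjective_rangeRestrict)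
    (Module.length_le_of_injective _ (Submodule.injective_subtype _))

/-- If `Extⁿ(k, M)` has length at most one, then `Extⁿ(-, M)` does not increase length. -/
lemma length_ext_le (h : Module.length R (ExtMod R (ResidueField R) M n) ≤ 1)
    {N : Type u} [AddCommGroup N] [Module R N] (hN : IsFiniteLength R N) :
    Module.length R (ExtMod R N M n) ≤ Module.length R N := by
  induction hN with
  | @of_subsingleton N _ _ _ =>
    have := subsingleton_ext_of_subsingleton (R := R) N M n
    exact Module.length_eq_zero.trans_le zero_le
  | @of_simple_quotient N _ _ S hS _ ih =>
    obtain ⟨I, hI, ⟨e⟩⟩ := isSimpleModule_iff_quot_maximal.1 hS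
    obtain rfl := IsLocalRing.eq_maximalIdeal hI
    have h1 : Module.length R (ExtMod R (N ⧸ S) M n) ≤ 1 :=
      (extCongrLeft e M n).length_eq.symm.trans_le h
    rw [Module.length_eq_add_of_exact S.subtype S.mkQ S.injective_subtype
      (Submodule.mkQ_surjective S) (LinearMap.exact_subtype_mkQ S), Module.length_eq_one R (N ⧸ S)]
    have hex := extPre_exact S.injective_subtype (LinearMap.exact_subtype_mkQ S)
      (Submodule.mkQ_surjective S) M n
    exact (length_le_add_of_exact hex).trans ((add_le_add h1 ih).trans_eq (add_comm _ _))

/-- If `Extⁿ(k, M)` has length one and both neighbouring `Ext` groups vanish, then `Extⁿ(-, M)` is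
exact on modules of finite length and preserves length. -/
lemma length_ext_eq (h : Module.length R (ExtMod R (ResidueField R) M n) = 1)
    (h0 : ∀ j, j + 1 = n → Subsingleton (ExtMod R (ResidueField R) M j))
    (h1 : Subsingleton (ExtMod R (ResidueField R) M (n + 1)))
    {N : Type u} [AddCommGroup N] [Module R N] (hN : IsFiniteLength R N) :
    Module.length R (ExtMod R N M n) = Module.length R N := by
  induction hN with
  | @of_subsingleton N _ _ _ =>
    have := subsingleton_ext_of_subsingleton (R := R) N M n
    exact Module.length_eq_zero.trans Module.length_eq_zero.symm
  | @of_simple_quotient N _ _ S hS hSf ih =>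
    obtain ⟨I, hI, ⟨e⟩⟩ := isSimpleModule_iff_quot_maximal.1 hS
    obtain rfl := IsLocalRing.eq_maximalIdeal hI
    have h2 : Module.length R (ExtMod R (N ⧸ S) M n) = 1 :=
      (extCongrLeft e M n).length_eq.symm.trans h
    have h3 : Subsingleton (ExtMod R (N ⧸ S) M (n + 1)) :=
      @Equiv.subsingleton _ _ (extCongrLeft e M (n + 1)).symm.toEquiv h1
    have hex := extPre_exact S.injective_subtype (LinearMap.exact_subtype_mkQ S)
      (Submodule.mkQ_surjective S) M n
    have hinj : Function.Injective (extPre S.mkQ M n) := by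
      obtain _ | n := n
      · refine (injective_iff_map_eq_zero _).2 fun x hx ↦ ?_
        exact Abelian.Ext.precomp_mk₀_injective_of_epi (ModuleCat.of R M) (ModuleCat.ofHom S.mkQ)
          (hg := (ModuleCat.epi_iff_surjective _).2 (Submodule.mkQ_surjective S))
          (hx.trans (map_zero (extPre S.mkQ M 0)).symm)
      · obtain ⟨δ, -, h5⟩ := exists_ext_connecting S.injective_subtype
          (LinearMap.exact_subtype_mkQ S) (Submodule.mkQ_surjective S) M n
        have := subsingleton_ext_of_isFiniteLength (h0 n rfl) hSf
        refine (injective_iff_map_eq_zero _).2 fun x hx ↦ ?_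
        obtain ⟨y, rfl⟩ := (h5 x).1 hx
        rw [Subsingleton.elim y 0, map_zero]
    have hsurj : Function.Surjective (extPre S.subtype M n) := by
      obtain ⟨δ, h5, -⟩ := exists_ext_connecting S.injective_subtype
          (LinearMap.exact_subtype_mkQ S) (Submodule.mkQ_surjective S) M n
      exact fun x ↦ (h5 x).1 (Subsingleton.elim _ _)
    rw [Module.length_eq_add_of_exact S.subtype S.mkQ S.injective_subtype
      (Submodule.mkQ_surjective S) (LinearMap.exact_subtype_mkQ S), Module.length_eq_one R (N ⧸ S),
      Module.length_eq_add_of_exact _ _ hinj hsurj hex, h2, ih, add_comm]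

end Length

/-! ### Dualizing modules and socles modulo a regular sequence -/

section Dualizing

open RingTheory.Sequence IsLocalRing

variable {A : Type u} [CommRing A] [IsLocalRing A]

lemma smul_residueField_eq_zero {r : A} (hr : r ∈ maximalIdeal A) (x : ResidueField A) :
    r • x = 0 := by
  obtain ⟨x, rfl⟩ := Ideal.Quotient.mk_surjective x
  exact Ideal.Quotient.eq_zero_iff_mem.2 (Ideal.mul_mem_right _ _ hr)

lemma smul_quotient_smul_top_eq_zero {A : Type*} [CommRing A] {ω : Type*} [AddCommGroup ω]
    [Module A ω] {J : Ideal A} {a : A} (ha : a ∈ J) (x : ω ⧸ J • (⊤ : Submodule A ω)) :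
    a • x = 0 := by
  obtain ⟨x, rfl⟩ := Submodule.Quotient.mk_surjective _ x
  exact (Submodule.Quotient.mk_eq_zero _).2 (Submodule.smul_mem_smul ha trivial)

lemma length_residueField : Module.length A (ResidueField A) = 1 :=
  have : IsSimpleModule A (ResidueField A) :=
    isSimpleModule_iff_quot_maximal.2 ⟨maximalIdeal A, inferInstance, ⟨LinearEquiv.refl _ _⟩⟩
  Module.length_eq_one A _

/-- An element of `Q` killed by the maximal ideal is a homomorphism `k → Q`. -/
lemma exists_hom_residueField {Q : Type*} [AddCommGroup Q] [Module A Q] {q : Q}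
    (hq : ∀ a ∈ maximalIdeal A, a • q = 0) : ∃ f : ResidueField A →ₗ[A] Q, f 1 = q :=
  ⟨Submodule.liftQ (maximalIdeal A) (LinearMap.toSpanSingleton A Q q) hq, one_smul A q⟩

/-- If `Ext^|rs|(k, ω) = 0`, the socle of `ω/(rs)ω` is zero. -/
lemma mem_ofList_smul_of_forall_smul_mem {ω : Type u} [AddCommGroup ω] [Module A ω] {rs : List A}
    (hω : IsWeaklyRegular ω rs) (hm : ∀ r ∈ rs, r ∈ maximalIdeal A)
    (h : Subsingleton (ExtMod A (ResidueField A) ω rs.length)) {w : ω}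
    (hw : ∀ a ∈ maximalIdeal A, a • w ∈ Ideal.ofList rs • (⊤ : Submodule A ω)) :
    w ∈ Ideal.ofList rs • (⊤ : Submodule A ω) := by
  obtain ⟨-, ⟨e⟩⟩ := ext_of_isWeaklyRegular (N := ResidueField A) hω
    fun r hr ↦ smul_residueField_eq_zero (hm r hr)
  obtain ⟨f, hf⟩ := exists_hom_residueField (q := (Submodule.Quotient.mk w :
    ω ⧸ Ideal.ofList rs • (⊤ : Submodule A ω)))
    fun a ha ↦ (Submodule.Quotient.mk_eq_zero _).2 (hw a ha)
  have : f = 0 := by rw [← e.apply_symm_apply f, Subsingleton.elim (e.symm f) 0, map_zero]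
  rw [this] at hf
  exact (Submodule.Quotient.mk_eq_zero _).1 hf.symm

/-- If `Ext^|rs|(k, ω) = k`, the socle of `ω/(rs)ω` is generated by one element. -/
lemma exists_socle_generator {ω : Type u} [AddCommGroup ω] [Module A ω] {rs : List A}
    (hω : IsWeaklyRegular ω rs) (hm : ∀ r ∈ rs, r ∈ maximalIdeal A)
    (h : ExtMod A (ResidueField A) ω rs.length ≃ₗ[A] ResidueField A) :
    ∃ v : ω, (∀ a ∈ maximalIdeal A, a • v ∈ Ideal.ofList rs • (⊤ : Submodule A ω)) ∧
      ∀ w : ω, (∀ a ∈ maximalIdeal A, a • w ∈ Ideal.ofList rs • (⊤ : Submodule A ω)) →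
        ∃ c : A, w - c • v ∈ Ideal.ofList rs • (⊤ : Submodule A ω) := by
  obtain ⟨-, ⟨e⟩⟩ := ext_of_isWeaklyRegular (N := ResidueField A) hω
    fun r hr ↦ smul_residueField_eq_zero (hm r hr)
  let g := e (h.symm 1)
  obtain ⟨v, hv⟩ := Submodule.Quotient.mk_surjective _ (g 1)
  refine ⟨v, fun a ha ↦ ?_, fun w hw ↦ ?_⟩
  · rw [← Submodule.Quotient.mk_eq_zero, Submodule.Quotient.mk_smul, hv, ← map_smul,
      smul_residueField_eq_zero ha, map_zero]
  · obtain ⟨f, hf⟩ := exists_hom_residueField (q := (Submodule.Quotient.mk w :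
      ω ⧸ Ideal.ofList rs • (⊤ : Submodule A ω)))
      fun a ha ↦ (Submodule.Quotient.mk_eq_zero _).2 (hw a ha)
    obtain ⟨c, hc⟩ := Ideal.Quotient.mk_surjective (h (e.symm f))
    have hfg : f = c • g := by
      have h1 : e.symm f = c • h.symm 1 := by
        rw [← map_smul, LinearEquiv.eq_symm_apply, ← hc, Algebra.smul_def, mul_one]
        rfl
      rw [← e.apply_symm_apply f, h1, map_smul]
    refine ⟨c, ?_⟩
    rw [← Submodule.Quotient.mk_eq_zero, Submodule.Quotient.mk_sub, Submodule.Quotient.mk_smul,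
      hv, ← hf, hfg]
    simp

section

variable {A : Type u} [CommRing A] {ω : Type u} [AddCommGroup ω] [Module A ω] {rs : List A}
  (hω : IsWeaklyRegular ω rs)
  (hlen : ∀ (N : Type u) [AddCommGroup N] [Module A N], IsFiniteLength A N →
    Module.length A (ExtMod A N ω rs.length) = Module.length A N)
  (hA : IsFiniteLength A (A ⧸ Ideal.ofList rs))

include hω hlen hA

lemma length_hom_quotient {J : Ideal A} (hJ : Ideal.ofList rs ≤ J) :
    Module.length A ((A ⧸ J) →ₗ[A] (ω ⧸ Ideal.ofList rs • (⊤ : Submodule A ω))) =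
      Module.length A (A ⧸ J) := by
  obtain ⟨-, ⟨e⟩⟩ := ext_of_isWeaklyRegular (N := A ⧸ J) hω fun r hr x ↦ by
    obtain ⟨x, rfl⟩ := Ideal.Quotient.mk_surjective x
    exact Ideal.Quotient.eq_zero_iff_mem.2
      (Ideal.mul_mem_right _ _ (hJ (Ideal.subset_span hr)))
  rw [← e.length_eq, hlen]
  exact hA.of_surjective (f := Submodule.factor hJ) (Submodule.factor_surjective hJ)

lemma length_quotient_smul_top :
    Module.length A (ω ⧸ Ideal.ofList rs • (⊤ : Submodule A ω)) =
      Module.length A (A ⧸ Ideal.ofList rs) := by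
  rw [← length_hom_quotient hω hlen hA le_rfl]
  exact (homQuotientEquiv (Ideal.ofList rs) _
    fun a ha q ↦ smul_quotient_smul_top_eq_zero ha q).length_eq.symm

/-- A dualizing module is faithful modulo a maximal regular sequence: with `J` the annihilator of
`ω/(rs)ω`, both `A/J` and `A/(rs)` have the length of `ω/(rs)ω = Hom(A/J, ω/(rs)ω)`. -/
lemma mem_ofList_of_smul_mem {a : A}
    (ha : ∀ w : ω, a • w ∈ Ideal.ofList rs • (⊤ : Submodule A ω)) : a ∈ Ideal.ofList rs := by
  let J := Module.annihilator A (ω ⧸ Ideal.ofList rs • (⊤ : Submodule A ω))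
  have hJ : Ideal.ofList rs ≤ J := fun r hr ↦
    Module.mem_annihilator.2 (smul_quotient_smul_top_eq_zero hr)
  have haJ : a ∈ J := Module.mem_annihilator.2 fun w ↦ by
    obtain ⟨w, rfl⟩ := Submodule.Quotient.mk_surjective _ w
    exact (Submodule.Quotient.mk_eq_zero _).2 (ha w)
  have h1 : Module.length A (A ⧸ J) = Module.length A (A ⧸ Ideal.ofList rs) := by
    rw [← length_quotient_smul_top hω hlen hA, ← length_hom_quotient hω hlen hA hJ]
    exact (homQuotientEquiv J _ fun a ha q ↦ Module.mem_annihilator.1 ha q).length_eq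
  have h2 := Module.length_eq_add_of_exact (LinearMap.ker (Submodule.factor hJ)).subtype
    (Submodule.factor hJ) (Submodule.injective_subtype _) (Submodule.factor_surjective hJ)
    (LinearMap.exact_subtype_ker_map _)
  have h3 : Module.length A (LinearMap.ker (Submodule.factor hJ)) = 0 := by
    have hfin := Module.length_ne_top_iff.2 hA
    rw [h1] at h2
    generalize Module.length A (LinearMap.ker (Submodule.factor hJ)) = e at h2 ⊢
    lift Module.length A (A ⧸ Ideal.ofList rs) to ℕ using hfin with l
    have he : e ≠ ⊤ := ne_top_of_le_ne_top (ENat.natCast_ne_top l) (le_self_add.trans_eq h2.symm)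
    lift e to ℕ using he
    norm_cast at *
    omega
  rw [Module.length_eq_zero_iff] at h3
  have h4 : (Submodule.Quotient.mk a : A ⧸ Ideal.ofList rs) ∈
      LinearMap.ker (Submodule.factor hJ) := by
    rw [LinearMap.mem_ker]
    exact (Submodule.Quotient.mk_eq_zero _).2 haJ
  exact (Submodule.Quotient.mk_eq_zero _).1
    (congrArg Subtype.val (Subsingleton.elim (⟨_, h4⟩ : LinearMap.ker (Submodule.factor hJ)) 0))

end

/-- For a dualizing module `ω` over a ring of dimension `d`, `Ext^d(-, ω)` preserves length. -/
lemma length_ext_eq_length {ω : Type u} [AddCommGroup ω] [Module A ω] {d : ℕ}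
    (h1 : ExtMod A (ResidueField A) ω d ≃ₗ[A] ResidueField A)
    (h2 : ∀ i ≠ d, Subsingleton (ExtMod A (ResidueField A) ω i))
    (N : Type u) [AddCommGroup N] [Module A N] (hN : IsFiniteLength A N) :
    Module.length A (ExtMod A N ω d) = Module.length A N :=
  length_ext_eq (h1.length_eq.trans length_residueField) (fun j hj ↦ h2 j (by omega))
    (h2 _ (by omega)) hN

end Dualizing

section Gorenstein

open RingTheory.Sequence IsLocalRing

variable {R : Type u} [CommRing R] [IsLocalRing R] [IsNoetherianRing R] {rs : List R}

/-- The quotient by a regular sequence has projective dimension the length of the sequence. -/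
lemma subsingleton_ext_quotient_ofList (hm : ∀ r ∈ rs, r ∈ maximalIdeal R)
    (hR : IsWeaklyRegular R rs) (M : Type u) [AddCommGroup M] [Module R M] {i : ℕ}
    (hi : rs.length < i) : Subsingleton (ExtMod R (R ⧸ Ideal.ofList rs) M i) := by
  have hreg : IsRegular R rs :=
    (isRegular_iff_isWeaklyRegular_of_subset_maximalIdeal hm).2 hR
  have h := ModuleCat.projectiveDimension_quotient_eq_length.{u} rs hreg
  have h1 : HasProjectiveDimensionLT (ModuleCat.of R (Shrink.{u} (R ⧸ Ideal.ofList rs))) i := by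
    rw [← projectiveDimension_lt_iff, h]
    exact_mod_cast hi
  have h2 : Subsingleton (ExtMod R (Shrink.{u} (R ⧸ Ideal.ofList rs)) M i) :=
    HasProjectiveDimensionLT.subsingleton _ i i le_rfl _
  exact @Equiv.subsingleton _ _
    (extCongrLeft (Shrink.linearEquiv R (R ⧸ Ideal.ofList rs)).symm M i).symm.toEquiv h2

/-- A Noetherian local ring `R` is Gorenstein if it has a regular sequence `rs` such that
`S = R/(rs)` has finite length and its socle is generated by one element `v`. With `n = |rs|`, the
assumption on the socle gives `length Extⁿ(k, R) ≤ 1`. In the long exact sequence of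
`0 → K → S → k → 0`, the equality `length Extⁿ(S, R) = length S` leaves no room for `Extⁿ⁺¹(k, R)`.
Since `S` has projective dimension `n`, the higher groups `Extⁱ(k, R)` then vanish as well. -/
theorem isGorensteinLocal_of_socle (hm : ∀ r ∈ rs, r ∈ maximalIdeal R)
    (hR : IsWeaklyRegular R rs) (hfin : IsFiniteLength R (R ⧸ Ideal.ofList rs))
    {v : R} (hv : ∀ a ∈ maximalIdeal R, a * v ∈ Ideal.ofList rs)
    (hsoc : ∀ r : R, (∀ a ∈ maximalIdeal R, a * r ∈ Ideal.ofList rs) →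
      ∃ c : R, r - c * v ∈ Ideal.ofList rs) : IsGorensteinLocal R := by
  have hQ : Ideal.ofList rs • (⊤ : Submodule R R) = Ideal.ofList rs := by simp
  let n := rs.length
  let S := R ⧸ Ideal.ofList rs
  have hle : Ideal.ofList rs ≤ maximalIdeal R := Ideal.span_le.2 hm
  -- the type of `R` is at most one
  have htype : Module.length R (ExtMod R (ResidueField R) R n) ≤ 1 := by
    obtain ⟨-, ⟨e⟩⟩ := ext_of_isWeaklyRegular (N := ResidueField R) hR
      fun r hr ↦ smul_residueField_eq_zero (hm r hr)
    rw [e.length_eq, ← length_residueField (A := R)]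
    obtain ⟨g, hg⟩ := exists_hom_residueField (A := R) (q := (Submodule.Quotient.mk v :
      R ⧸ Ideal.ofList rs • (⊤ : Submodule R R)))
      fun a ha ↦ (Submodule.Quotient.mk_eq_zero _).2 (by rw [hQ]; exact hv a ha)
    obtain ⟨f, hf⟩ := exists_hom_residueField (A := R) (q := g) fun a ha ↦ by
      ext
      simp only [LinearMap.smul_apply, ← map_smul, smul_residueField_eq_zero ha, map_zero,
        LinearMap.zero_apply]
    refine Module.length_le_of_surjective f fun h ↦ ?_
    obtain ⟨r, hr⟩ := Submodule.Quotient.mk_surjective _ (h 1)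
    obtain ⟨c, hc⟩ := hsoc r fun a ha ↦ by
      have : (Submodule.Quotient.mk (a • r) : R ⧸ Ideal.ofList rs • (⊤ : Submodule R R)) = 0 := by
        rw [Submodule.Quotient.mk_smul, hr, ← map_smul, smul_residueField_eq_zero ha, map_zero]
      rwa [Submodule.Quotient.mk_eq_zero, hQ] at this
    refine ⟨c • 1, ?_⟩
    rw [map_smul, hf]
    refine LinearMap.ext fun x ↦ ?_
    obtain ⟨x, rfl⟩ := Ideal.Quotient.mk_surjective x
    have hx : (Ideal.Quotient.mk (maximalIdeal R) x : ResidueField R) = x • 1 := by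
      rw [Algebra.smul_def, mul_one]; rfl
    have h1 : (c • g) 1 = h 1 := by
      rw [LinearMap.smul_apply, hg, ← hr, ← Submodule.Quotient.mk_smul, eq_comm, ← sub_eq_zero,
        ← Submodule.Quotient.mk_sub, Submodule.Quotient.mk_eq_zero, hQ]
      exact hc
    exact (congrArg _ hx).trans (((c • g).map_smul x 1).trans ((congrArg (x • ·) h1).trans
      ((h.map_smul x 1).symm.trans (congrArg _ hx).symm)))
  have hSn : Module.length R (ExtMod R S R n) = Module.length R S := by
    obtain ⟨-, ⟨e⟩⟩ := ext_of_isWeaklyRegular (N := S) hR fun r hr x ↦ by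
      obtain ⟨x, rfl⟩ := Ideal.Quotient.mk_surjective x
      exact Ideal.Quotient.eq_zero_iff_mem.2
        (Ideal.mul_mem_right _ _ (Ideal.subset_span hr))
    rw [e.length_eq, (homQuotientEquiv (Ideal.ofList rs) _
      fun a ha q ↦ smul_quotient_smul_top_eq_zero ha q).length_eq]
    exact (Submodule.quotEquivOfEq _ _ hQ).length_eq
  -- `0 → K → S → k → 0`
  let p : S →ₗ[R] ResidueField R := Submodule.factor hle
  have hp : Function.Surjective p := Submodule.factor_surjective hle
  let K := LinearMap.ker p
  have hKfin : IsFiniteLength R K := hfin.of_injective K.injective_subtype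
  have hex : Function.Exact K.subtype p := LinearMap.exact_subtype_ker_map p
  have hlS : Module.length R S = Module.length R K + 1 := by
    rw [Module.length_eq_add_of_exact K.subtype p K.injective_subtype hp hex, length_residueField]
  have hn1 : Subsingleton (ExtMod R (ResidueField R) R (n + 1)) := by
    obtain ⟨δ, h1, h2⟩ := exists_ext_connecting K.injective_subtype hex hp R n
    have hS1 := subsingleton_ext_quotient_ofList hm hR R (Nat.lt_succ_self _)
    have hδ : Function.Surjective δ := fun y ↦ (h2 y).1 (hS1.elim _ _)
    have hK := length_ext_le htype hKfin
    have h3 := length_le_add_of_exact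
      (f := extPre p R n) (g := (extPre K.subtype R n).rangeRestrict) (fun x ↦ by
        simpa [Subtype.ext_iff] using extPre_exact K.injective_subtype hex hp R n x)
    have h4 := Module.length_eq_add_of_exact (LinearMap.range (extPre K.subtype R n)).subtype δ
      (Submodule.injective_subtype _) hδ (fun x ↦ by simpa using h1 x)
    rw [← Module.length_eq_zero_iff (R := R)]
    have hKt := Module.length_ne_top_iff.2 hKfin
    have h5 := h3.trans (add_le_add_left htype _)
    rw [show Module.length R (ExtMod R S R n) = _ from hSn, hlS] at h5
    rw [h4] at hK
    generalize Module.length R (ExtMod R (ResidueField R) R (n + 1)) = e at *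
    generalize Module.length R (LinearMap.range (extPre K.subtype R n)) = r at *
    lift Module.length R K to ℕ using hKt with l
    have hr : r ≠ ⊤ := ne_top_of_le_ne_top (ENat.natCast_ne_top l) (le_self_add.trans hK)
    have he : e ≠ ⊤ := ne_top_of_le_ne_top (ENat.natCast_ne_top l) (le_add_self.trans hK)
    lift r to ℕ using hr
    lift e to ℕ using he
    norm_cast at *
    omega
  refine ⟨inferInstance, n, hasInjectiveDimensionLE_of_ext_residueField fun i hi ↦ ?_⟩
  obtain ⟨j, rfl⟩ := Nat.exists_eq_add_of_lt hi
  induction j with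
  | zero => exact hn1
  | succ j ih =>
    exact subsingleton_ext_succ_right K.injective_subtype hex hp
      (subsingleton_ext_of_isFiniteLength (ih (by omega)) hKfin)
      (subsingleton_ext_quotient_ofList hm hR R (by omega))

end Gorenstein

/-! ### Regular sequences along a surjection of local rings -/

section Quotient

open RingTheory.Sequence IsLocalRing

lemma mem_ofList_map_smul_iff {R A M : Type*} [CommRing R] [CommRing A] [Algebra R A]
    [AddCommGroup M] [Module A M] [Module R M] [IsScalarTower R A M] {rs : List R} {x : M} :
    x ∈ Ideal.ofList (rs.map (algebraMap R A)) • (⊤ : Submodule A M) ↔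
      x ∈ Ideal.ofList rs • (⊤ : Submodule R M) := by
  rw [← Ideal.map_ofList, ← Submodule.restrictScalars_mem R, Ideal.smul_restrictScalars,
    Submodule.restrictScalars_top]

lemma mem_ofList_map_iff {R A : Type*} [CommRing R] [CommRing A] [Algebra R A]
    {rs : List R} {x : A} :
    x ∈ Ideal.ofList (rs.map (algebraMap R A)) ↔ x ∈ Ideal.ofList rs • (⊤ : Submodule R A) := by
  rw [← mem_ofList_map_smul_iff (A := A)]
  simp

variable {R A : Type u} [CommRing R] [IsLocalRing R] [CommRing A] [IsLocalRing A] [Algebra R A]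

lemma map_mem_ofList_smul_iff {R A : Type*} [CommRing R] [CommRing A] [Algebra R A]
    (hs : Function.Surjective (algebraMap R A)) {rs : List R} {r : R} :
    algebraMap R A r ∈ Ideal.ofList rs • (⊤ : Submodule R A) ↔
      ∃ s ∈ Ideal.ofList rs, algebraMap R A s = algebraMap R A r := by
  rw [← mem_ofList_map_iff, ← Ideal.map_ofList, Ideal.mem_map_iff_of_surjective _ hs]

lemma algebraMap_mem_maximalIdeal_iff (hs : Function.Surjective (algebraMap R A)) {r : R} :
    algebraMap R A r ∈ maximalIdeal A ↔ r ∈ maximalIdeal R := by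
  have := IsLocalHom.of_surjective (algebraMap R A) hs
  simp

/-- Regular sequences over a quotient ring lift. -/
lemma exists_isWeaklyRegular_lift (hs : Function.Surjective (algebraMap R A)) {M : Type*}
    [AddCommGroup M] [Module A M] [Module R M] [IsScalarTower R A M] {rs : List A}
    (hm : ∀ r ∈ rs, r ∈ maximalIdeal A) (h : IsWeaklyRegular M rs) :
    ∃ rs' : List R, rs'.length = rs.length ∧ (∀ r ∈ rs', r ∈ maximalIdeal R) ∧
      IsWeaklyRegular M rs' := by
  obtain ⟨rs', rfl⟩ := List.map_surjective_iff.2 hs rs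
  refine ⟨rs', by simp, fun r hr ↦ ?_, (isWeaklyRegular_map_algebraMap_iff A M rs').1 h⟩
  exact (algebraMap_mem_maximalIdeal_iff hs).1 (hm _ (List.mem_map_of_mem hr))

lemma subsingleton_ext_of_isWeaklyRegular_quotient (hs : Function.Surjective (algebraMap R A))
    {M : Type u} [AddCommGroup M] [Module A M] [Module R M] [IsScalarTower R A M] {rs : List A}
    (hm : ∀ r ∈ rs, r ∈ maximalIdeal A) (h : IsWeaklyRegular M rs) {i : ℕ} (hi : i < rs.length) :
    Subsingleton (ExtMod R (ResidueField R) M i) := by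
  obtain ⟨rs', hl, hm', h'⟩ := exists_isWeaklyRegular_lift hs hm h
  exact (ext_of_isWeaklyRegular h' fun r hr ↦ smul_residueField_eq_zero (hm' r hr)).1 i (by omega)

/-- Depth as measured by `Ext` from the residue field does not change along a surjection. -/
lemma subsingleton_ext_of_subsingleton_ext_quotient [IsNoetherianRing A]
    (hs : Function.Surjective (algebraMap R A))
    {M : Type u} [AddCommGroup M] [Module A M] [Module R M] [IsScalarTower R A M] [Nontrivial M]
    [Module.Finite A M] {n : ℕ} (h : ∀ i < n, Subsingleton (ExtMod A (ResidueField A) M i))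
    {i : ℕ} (hi : i < n) :
    Subsingleton (ExtMod R (ResidueField R) M i) := by
  have hlt : maximalIdeal A • (⊤ : Submodule A M) < ⊤ :=
    lt_top_iff_ne_top.2 (Submodule.top_ne_ideal_smul_of_le_jacobson_annihilator
      (maximalIdeal_le_jacobson _)).symm
  have hsupp : Module.support A (A ⧸ maximalIdeal A) =
      PrimeSpectrum.zeroLocus (maximalIdeal A) := by
    rw [Module.support_eq_zeroLocus, Ideal.annihilator_quotient]
  obtain ⟨rs, hl, hm, hreg⟩ := ModuleCat.exists_isRegular_of_exists_subsingleton_ext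
    (maximalIdeal A) n (ModuleCat.of A M) hlt (ModuleCat.of A (A ⧸ maximalIdeal A)) hsupp h
  exact subsingleton_ext_of_isWeaklyRegular_quotient hs hm hreg.toIsWeaklyRegular (by omega)

section Sides

variable (hs : Function.Surjective (algebraMap R A)) {ω : Type u} [AddCommGroup ω] [Module A ω]
  [Module R ω] [IsScalarTower R A ω] {rs : List R} (hm : ∀ r ∈ rs, r ∈ maximalIdeal R)
  (hω : IsWeaklyRegular ω rs)

include hs hm in
lemma forall_mem_map_maximalIdeal (r : A) (hr : r ∈ rs.map (algebraMap R A)) :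
    r ∈ maximalIdeal A := by
  obtain ⟨s, hs', rfl⟩ := List.mem_map.1 hr
  exact (algebraMap_mem_maximalIdeal_iff hs).2 (hm s hs')

include hs hm hω

/-- The form of `mem_ofList_smul_of_forall_smul_mem` for a sequence in a ring `R` surjecting onto
`A`. -/
lemma mem_ofList_smul_of_forall_smul_mem_quotient
    (h : Subsingleton (ExtMod A (ResidueField A) ω rs.length)) {w : ω}
    (hw : ∀ a ∈ maximalIdeal R, a • w ∈ Ideal.ofList rs • (⊤ : Submodule R ω)) :
    w ∈ Ideal.ofList rs • (⊤ : Submodule R ω) := by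
  refine mem_ofList_map_smul_iff.1 (mem_ofList_smul_of_forall_smul_mem (A := A)
    ((isWeaklyRegular_map_algebraMap_iff A ω rs).2 hω) (forall_mem_map_maximalIdeal hs hm)
    (by simpa using h) fun a ha ↦ ?_)
  obtain ⟨a, rfl⟩ := hs a
  rw [mem_ofList_map_smul_iff, algebraMap_smul]
  exact hw a ((algebraMap_mem_maximalIdeal_iff hs).1 ha)

/-- The form of `exists_socle_generator` for a sequence in a ring `R` surjecting onto `A`. -/
lemma exists_socle_generator_quotient
    (h : Nonempty (ExtMod A (ResidueField A) ω rs.length ≃ₗ[A] ResidueField A)) :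
    ∃ v : ω, (∀ a ∈ maximalIdeal R, a • v ∈ Ideal.ofList rs • (⊤ : Submodule R ω)) ∧
      ∀ w : ω, (∀ a ∈ maximalIdeal R, a • w ∈ Ideal.ofList rs • (⊤ : Submodule R ω)) →
        ∃ c : R, w - c • v ∈ Ideal.ofList rs • (⊤ : Submodule R ω) := by
  rw [← List.length_map (algebraMap R A)] at h
  obtain ⟨h⟩ := h
  obtain ⟨v, hv, H⟩ := exists_socle_generator (A := A)
    ((isWeaklyRegular_map_algebraMap_iff A ω rs).2 hω) (forall_mem_map_maximalIdeal hs hm) h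
  refine ⟨v, fun a ha ↦ ?_, fun w hw ↦ ?_⟩
  · rw [← mem_ofList_map_smul_iff (A := A), ← algebraMap_smul A a v]
    exact hv _ ((algebraMap_mem_maximalIdeal_iff hs).2 ha)
  · obtain ⟨c, hc⟩ := H w fun a ha ↦ by
      obtain ⟨a, rfl⟩ := hs a
      rw [mem_ofList_map_smul_iff, algebraMap_smul]
      exact hw a ((algebraMap_mem_maximalIdeal_iff hs).1 ha)
    obtain ⟨c, rfl⟩ := hs c
    exact ⟨c, by rwa [mem_ofList_map_smul_iff, algebraMap_smul] at hc⟩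

variable [IsNoetherianRing A] (hA : IsWeaklyRegular A rs) (hd : ringKrullDim A = rs.length)

omit hω in
include hA hd in
lemma isArtinianRing_quotient_ofList_map :
    IsArtinianRing (A ⧸ Ideal.ofList (rs.map (algebraMap R A))) := by
  have hreg : IsRegular A (rs.map (algebraMap R A)) :=
    IsRegular.of_isWeaklyRegular_of_mem_maximalIdeal A (forall_mem_map_maximalIdeal hs hm)
      ((isWeaklyRegular_map_algebraMap_iff A A rs).2 hA)
  have h := ringKrullDim_add_length_eq_ringKrullDim_of_isRegular _ hreg
  rw [hd, List.length_map] at h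
  have : ringKrullDim (A ⧸ Ideal.ofList (rs.map (algebraMap R A))) ≤ 0 := by
    generalize ringKrullDim (A ⧸ Ideal.ofList (rs.map (algebraMap R A))) = e at h
    induction e with
    | bot => exact bot_le
    | coe e =>
      have h' : e + (rs.length : ℕ∞) = (rs.length : ℕ∞) := by exact_mod_cast h
      have he : e ≠ ⊤ := ne_top_of_le_ne_top (ENat.natCast_ne_top _) (le_self_add.trans_eq h')
      lift e to ℕ using he
      norm_cast at *
      omega
  rw [isArtinianRing_iff_krullDimLE_zero, Ring.krullDimLE_iff]
  exact_mod_cast this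

omit hω in
include hA hd in
lemma exists_pow_maximalIdeal_map_mem :
    ∃ t : ℕ, ∀ a ∈ maximalIdeal R ^ t,
      algebraMap R A a ∈ Ideal.ofList rs • (⊤ : Submodule R A) := by
  have := isArtinianRing_quotient_ofList_map hs hm hA hd
  obtain ⟨t, ht⟩ := exists_maximalIdeal_pow_le_of_isArtinianRing_quotient
    (Ideal.ofList (rs.map (algebraMap R A)))
  refine ⟨t, fun a ha ↦ mem_ofList_map_iff.1 (ht ?_)⟩
  have h1 : (maximalIdeal R).map (algebraMap R A) ≤ maximalIdeal A :=
    Ideal.map_le_iff_le_comap.2 fun r hr ↦ (algebraMap_mem_maximalIdeal_iff hs).2 hr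
  refine Ideal.pow_right_mono h1 t ?_
  rw [← Ideal.map_pow]
  exact Ideal.mem_map_of_mem _ ha

variable (h1 : Nonempty (ExtMod A (ResidueField A) ω rs.length ≃ₗ[A] ResidueField A))
  (h2 : ∀ i ≠ rs.length, Subsingleton (ExtMod A (ResidueField A) ω i))

include hA hd h1 h2

/-- The form of `mem_ofList_of_smul_mem` for a sequence in a ring `R` surjecting onto `A`. -/
lemma map_mem_ofList_smul_of_smul_mem {r : R}
    (hr : ∀ w : ω, r • w ∈ Ideal.ofList rs • (⊤ : Submodule R ω)) :
    algebraMap R A r ∈ Ideal.ofList rs • (⊤ : Submodule R A) := by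
  have := isArtinianRing_quotient_ofList_map hs hm hA hd
  rw [← List.length_map (algebraMap R A)] at h1 h2
  obtain ⟨h1⟩ := h1
  refine mem_ofList_map_iff.1 (mem_ofList_of_smul_mem (ω := ω)
    ((isWeaklyRegular_map_algebraMap_iff A ω rs).2 hω)
    (fun N _ _ hN ↦ length_ext_eq_length h1 h2 N hN)
    (isFiniteLength_quotient_of_isArtinianRing _) fun w ↦ ?_)
  rw [mem_ofList_map_smul_iff, algebraMap_smul]
  exact hr w

/-- Modulo a maximal regular sequence `ω` and `A` have the same length, so an injection
`ω/(rs)ω → A/(rs)` is onto. -/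
lemma exists_sub_mem_of_injective_mod (f : ω →ₗ[R] A)
    (hf : ∀ w, f w ∈ Ideal.ofList rs • (⊤ : Submodule R A) →
      w ∈ Ideal.ofList rs • (⊤ : Submodule R ω)) (x : A) :
    ∃ w, x - f w ∈ Ideal.ofList rs • (⊤ : Submodule R A) := by
  have := isArtinianRing_quotient_ofList_map hs hm hA hd
  rw [← List.length_map (algebraMap R A)] at h1 h2
  obtain ⟨h1⟩ := h1
  have hfin := isFiniteLength_quotient_of_isArtinianRing (Ideal.ofList (rs.map (algebraMap R A)))
  have hlen := length_quotient_smul_top (ω := ω) ((isWeaklyRegular_map_algebraMap_iff A ω rs).2 hω)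
    (fun N _ _ hN ↦ length_ext_eq_length h1 h2 N hN) hfin
  let f' : ω →ₗ[A] A :=
    { f with
      map_smul' := fun a w ↦ by
        obtain ⟨a, rfl⟩ := hs a
        rw [algebraMap_smul, RingHom.id_apply, algebraMap_smul]
        exact f.map_smul a w }
  let I := Ideal.ofList (rs.map (algebraMap R A))
  have hle : I • (⊤ : Submodule A ω) ≤ Submodule.comap f' I := by
    refine Submodule.smul_le.2 fun a ha w _ ↦ ?_
    rw [Submodule.mem_comap, map_smul]
    exact Ideal.mul_mem_right _ _ ha
  let g := Submodule.mapQ (I • (⊤ : Submodule A ω)) I f' hle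
  have hg : Function.Injective g := by
    refine (injective_iff_map_eq_zero g).2 fun w hw ↦ ?_
    obtain ⟨w, rfl⟩ := Submodule.Quotient.mk_surjective _ w
    rw [Submodule.mapQ_apply, Submodule.Quotient.mk_eq_zero] at hw
    rw [Submodule.Quotient.mk_eq_zero]
    exact mem_ofList_map_smul_iff.2 (hf w (mem_ofList_map_iff.1 hw))
  have hsurj : LinearMap.range g = ⊤ := by
    by_contra hne
    obtain ⟨hn, ha⟩ := isFiniteLength_iff_isNoetherian_isArtinian.1 hfin
    have hlt := Submodule.length_lt hne
    rw [← (LinearEquiv.ofInjective g hg).length_eq, hlen] at hlt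
    exact lt_irrefl _ hlt
  obtain ⟨w, hw⟩ := LinearMap.range_eq_top.1 hsurj (Submodule.Quotient.mk x)
  obtain ⟨w, rfl⟩ := Submodule.Quotient.mk_surjective _ w
  refine ⟨w, mem_ofList_map_iff.1 ?_⟩
  rw [← Submodule.Quotient.mk_eq_zero, Submodule.Quotient.mk_sub, ← hw, Submodule.mapQ_apply,
    sub_eq_zero]
  rfl

end Sides

end Quotient

/-! ### Local double extensions -/

section LocalLinkage

open RingTheory.Sequence IsLocalRing

lemma map_mem_of_mem_smul_top {R ω : Type*} [CommRing R] [AddCommGroup ω] [Module R ω] {J : Ideal R}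
    (i : ω →ₗ[R] R) {w : ω} (hw : w ∈ J • (⊤ : Submodule R ω)) : i w ∈ J := by
  have h : (J • (⊤ : Submodule R ω)).map i ≤ J := by
    rw [Submodule.map_smul'']
    exact Submodule.smul_le.2 fun a ha r _ ↦ Ideal.mul_mem_right _ _ ha
  exact h (Submodule.mem_map_of_mem hw)

variable {R A₁ A₂ : Type u} [CommRing R] [IsLocalRing R]
  [CommRing A₁] [IsLocalRing A₁] [Algebra R A₁] [CommRing A₂] [IsLocalRing A₂] [Algebra R A₂]
  (hs₁ : Function.Surjective (algebraMap R A₁)) (hs₂ : Function.Surjective (algebraMap R A₂))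
  {ω₁ ω₂ : Type u} [AddCommGroup ω₁] [Module A₁ ω₁] [Module R ω₁] [IsScalarTower R A₁ ω₁]
  [AddCommGroup ω₂] [Module A₂ ω₂] [Module R ω₂] [IsScalarTower R A₂ ω₂]
  {i₁ : ω₁ →ₗ[R] R} {i₂ : ω₂ →ₗ[R] R} (hi₁ : Function.Injective i₁) (hi₂ : Function.Injective i₂)
  (hex₁ : Function.Exact i₁ (algebraMap R A₂)) (hex₂ : Function.Exact i₂ (algebraMap R A₁))

section Core

lemma mem_maximalIdeal_of_exact {R A : Type u} {ω : Type*} [CommRing R] [IsLocalRing R] [CommRing A]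
    [IsLocalRing A] [Algebra R A] {i : ω → R} (hs : Function.Surjective (algebraMap R A))
    (hex : Function.Exact i (algebraMap R A)) (w : ω) : i w ∈ maximalIdeal R := by
  rw [← algebraMap_mem_maximalIdeal_iff hs, hex.apply_apply_eq_zero]
  exact zero_mem _

lemma mem_smul_top_of_map_mem {R A ω : Type*} [CommRing R] [CommRing A] [Algebra R A]
    [AddCommGroup ω] [Module R ω] {i : ω →ₗ[R] R} (hs : Function.Surjective (algebraMap R A))
    (hi : Function.Injective i) (hex : Function.Exact i (algebraMap R A)) {rs : List R}
    (hA : IsWeaklyRegular A rs) {w : ω} (hw : i w ∈ Ideal.ofList rs) :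
    w ∈ Ideal.ofList rs • (⊤ : Submodule R ω) :=
  mem_ofList_smul_of_map_mem (g := Algebra.linearMap R A) hi hex hs hA (by simpa using hw)

variable {rs : List R} (hm : ∀ r ∈ rs, r ∈ maximalIdeal R)
  (hA₁ : IsWeaklyRegular A₁ rs) (hA₂ : IsWeaklyRegular A₂ rs)
  (hω₁ : IsWeaklyRegular ω₁ rs) (hω₂ : IsWeaklyRegular ω₂ rs)
  [IsNoetherianRing A₁] (hd₁ : ringKrullDim A₁ = rs.length)
  (h1 : Nonempty (ExtMod A₁ (ResidueField A₁) ω₁ rs.length ≃ₗ[A₁] ResidueField A₁))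
  (h2 : ∀ i ≠ rs.length, Subsingleton (ExtMod A₁ (ResidueField A₁) ω₁ i))

include hs₁ hs₂ hi₁ hi₂ hex₁ hex₂ hm hA₁ hA₂ hω₁ hω₂ hd₁ h1 h2

/-- The two components of a local double extension by dualizing modules cannot have different
dimensions. Suppose that `dim A₁ = |rs|` and that `ω₂` has greater depth. Then `ω₂/(rs)ω₂` has no
socle, so no nonzero element of it is killed by a power of the maximal ideal. Modulo `(rs)` the
images of `ω₁` and `ω₂` in `R` therefore meet in zero only, so `ω₁/(rs)ω₁ → A₁/(rs)` is injective.
It is onto by comparison of lengths, so `1` is a sum of elements of the maximal ideal of `R`. -/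
lemma false_of_subsingleton_ext_residueField
    (h3 : Subsingleton (ExtMod A₂ (ResidueField A₂) ω₂ rs.length)) :
    False := by
  obtain ⟨t, ht⟩ := exists_pow_maximalIdeal_map_mem hs₁ hm hA₁ hd₁
  have hpow : ∀ (t : ℕ) (z : ω₂),
      (∀ a ∈ maximalIdeal R ^ t, a • z ∈ Ideal.ofList rs • (⊤ : Submodule R ω₂)) →
        z ∈ Ideal.ofList rs • (⊤ : Submodule R ω₂) := by
    intro t
    induction t with
    | zero => exact fun z hz ↦ by simpa using hz 1 (by simp)
    | succ t ih =>
      refine fun z hz ↦ mem_ofList_smul_of_forall_smul_mem_quotient hs₂ hm hω₂ h3 fun b hb ↦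
        ih _ fun a ha ↦ ?_
      rw [← mul_smul]
      exact hz _ (by rw [pow_succ]; exact Ideal.mul_mem_mul ha hb)
  -- modulo `(rs)`, the images of `i₁` and `i₂` meet in zero only
  have hK : ∀ (z : ω₂) (w : ω₁) (s : R), s ∈ Ideal.ofList rs → i₂ z = i₁ w + s →
      z ∈ Ideal.ofList rs • (⊤ : Submodule R ω₂) := by
    intro z w s hsJ hz
    refine hpow t z fun a ha ↦ mem_smul_top_of_map_mem hs₁ hi₂ hex₂ hA₁ ?_
    obtain ⟨s', hs', has⟩ := (map_mem_ofList_smul_iff hs₁).1 (ht a ha)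
    have haw : a • w ∈ Ideal.ofList rs • (⊤ : Submodule R ω₁) := by
      rw [← algebraMap_smul A₁ a w, ← has, algebraMap_smul]
      exact Submodule.smul_mem_smul hs' trivial
    rw [map_smul, hz, smul_add, ← map_smul]
    exact add_mem (map_mem_of_mem_smul_top i₁ haw) (Ideal.mul_mem_left _ _ hsJ)
  obtain ⟨w, hw⟩ := exists_sub_mem_of_injective_mod hs₁ hm hω₁ hA₁ hd₁ h1 h2
    (Algebra.linearMap R A₁ ∘ₗ i₁) (fun w hw ↦ by
      obtain ⟨s, hsJ, hsw⟩ := (map_mem_ofList_smul_iff hs₁).1 hw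
      obtain ⟨z, hz⟩ := (hex₂ (i₁ w - s)).1 (by rw [map_sub, hsw, sub_self])
      have hzJ := map_mem_of_mem_smul_top i₂ (hK z w (-s) (neg_mem hsJ) (by rw [hz]; ring))
      refine mem_smul_top_of_map_mem hs₂ hi₁ hex₁ hA₂ ?_
      rw [hz] at hzJ
      simpa using add_mem hzJ hsJ) 1
  obtain ⟨s, hsJ, hsw⟩ := (map_mem_ofList_smul_iff (r := 1 - i₁ w) hs₁).1 (by simpa using hw)
  obtain ⟨z, hz⟩ := (hex₂ (1 - i₁ w - s)).1 (by rw [map_sub, hsw, sub_self])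
  have hle : Ideal.ofList rs ≤ maximalIdeal R := Ideal.span_le.2 hm
  refine (Ideal.ne_top_iff_one _).1 (maximalIdeal.isMaximal R).ne_top ?_
  have := add_mem (add_mem (mem_maximalIdeal_of_exact hs₁ hex₂ z) (hle hsJ))
    (mem_maximalIdeal_of_exact hs₂ hex₁ w)
  rw [hz] at this
  convert! this using 1
  ring

omit h2 in
/-- If both components have dimension `|rs|`, then `R/(rs)` is Artinian, and its socle is the socle
of `ω₁/(rs)ω₁`: a socle element kills `ω₂/(rs)ω₂`, which is faithful over `A₂/(rs)`, so it lies in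
the kernel `ω₁/(rs)ω₁` of `R/(rs) → A₂/(rs)`. -/
lemma isGorensteinLocal_of_ringKrullDim_eq [IsNoetherianRing R] [IsNoetherianRing A₂]
    (hR : IsWeaklyRegular R rs) (hd₂ : ringKrullDim A₂ = rs.length)
    (h3 : Nonempty (ExtMod A₂ (ResidueField A₂) ω₂ rs.length ≃ₗ[A₂] ResidueField A₂))
    (h4 : ∀ i ≠ rs.length, Subsingleton (ExtMod A₂ (ResidueField A₂) ω₂ i)) :
    IsGorensteinLocal R := by
  obtain ⟨t₁, ht₁⟩ := exists_pow_maximalIdeal_map_mem hs₁ hm hA₁ hd₁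
  obtain ⟨t₂, ht₂⟩ := exists_pow_maximalIdeal_map_mem hs₂ hm hA₂ hd₂
  have hle : maximalIdeal R ^ (t₁ + t₂) ≤ Ideal.ofList rs := by
    rw [pow_add, Ideal.mul_le]
    intro a ha b hb
    obtain ⟨s, hsJ, hsa⟩ := (map_mem_ofList_smul_iff hs₁).1 (ht₁ a ha)
    obtain ⟨s', hsJ', hsb⟩ := (map_mem_ofList_smul_iff hs₂).1 (ht₂ b hb)
    obtain ⟨w, hw⟩ := (hex₁ (b - s')).1 (by rw [map_sub, hsb, sub_self])
    have haw : a • w ∈ Ideal.ofList rs • (⊤ : Submodule R ω₁) := by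
      rw [← algebraMap_smul A₁ a w, ← hsa, algebraMap_smul]
      exact Submodule.smul_mem_smul hsJ trivial
    have h5 := map_mem_of_mem_smul_top i₁ haw
    rw [map_smul, hw, smul_eq_mul, mul_sub] at h5
    simpa using add_mem h5 (Ideal.mul_mem_left _ a hsJ')
  have hart := isArtinianRing_quotient_of_pow_le hle
  obtain ⟨v, hv, hsoc⟩ := exists_socle_generator_quotient hs₁ hm hω₁ h1
  refine isGorensteinLocal_of_socle (v := i₁ v) hm hR
    (isFiniteLength_quotient_of_isArtinianRing _) (fun a ha ↦ ?_) fun r hr ↦ ?_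
  · rw [← smul_eq_mul, ← map_smul]
    exact map_mem_of_mem_smul_top i₁ (hv a ha)
  · have hr2 := map_mem_ofList_smul_of_smul_mem (ω := ω₂) hs₂ hm hω₂ hA₂ hd₂ h3 h4 (r := r)
      fun w ↦ mem_smul_top_of_map_mem hs₁ hi₂ hex₂ hA₁ (by
        rw [map_smul, smul_eq_mul, mul_comm]
        exact hr _ (mem_maximalIdeal_of_exact hs₁ hex₂ w))
    obtain ⟨s, hsJ, hsr⟩ := (map_mem_ofList_smul_iff hs₂).1 hr2
    obtain ⟨w, hw⟩ := (hex₁ (r - s)).1 (by rw [map_sub, hsr, sub_self])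
    obtain ⟨c, hc⟩ := hsoc w fun a ha ↦ mem_smul_top_of_map_mem hs₂ hi₁ hex₁ hA₂ (by
      rw [map_smul, hw, smul_eq_mul, mul_sub]
      exact sub_mem (hr a ha) (Ideal.mul_mem_left _ _ hsJ))
    refine ⟨c, ?_⟩
    have h5 := map_mem_of_mem_smul_top i₁ hc
    rw [map_sub, map_smul, hw, smul_eq_mul] at h5
    have := add_mem h5 hsJ
    rwa [show r - s - c * i₁ v + s = r - c * i₁ v by ring] at this

end Core

/-- Over a ring `R` surjecting onto a Cohen–Macaulay local ring `A` of dimension `d`, both `A` and a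
dualizing module of `A` have depth at least `d`, as measured by `Ext` from the residue field. -/
lemma depth_of_isDualizingModule {A ω : Type u} [CommRing A] [IsLocalRing A] [Algebra R A]
    (hs : Function.Surjective (algebraMap R A)) [AddCommGroup ω] [Module A ω] [Module R ω]
    [IsScalarTower R A ω] (hCM : IsCohenMacaulayLocal A)
    (hω : IsDualizingModule A (ModuleCat.of A ω)) :
    ∃ d : ℕ, ringKrullDim A = d ∧
      Nonempty (ExtMod A (ResidueField A) ω d ≃ₗ[A] ResidueField A) ∧
      (∀ i ≠ d, Subsingleton (ExtMod A (ResidueField A) ω i)) ∧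
      (∀ i < d, Subsingleton (ExtMod R (ResidueField R) A i)) ∧
      ∀ i < d, Subsingleton (ExtMod R (ResidueField R) ω i) := by
  obtain ⟨hfin, d, hd, h1, h2⟩ := hω
  obtain ⟨hN, rs, hm, hreg, hl⟩ := hCM
  have hld : rs.length = d := by
    rw [hd] at hl
    exact_mod_cast hl
  have hnt : Nontrivial ω := by
    by_contra hns
    rw [not_nontrivial_iff_subsingleton] at hns
    obtain ⟨e⟩ := h1
    have : Limits.IsZero (ModuleCat.of A ω) := ModuleCat.isZero_of_subsingleton (ModuleCat.of A ω)
    have h0 : ∀ x : ExtMod A (ResidueField A) ω d, x = 0 := fun x ↦ by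
      rw [← x.comp_mk₀_id, this.eq_zero_of_src (𝟙 _), Abelian.Ext.mk₀_zero, Abelian.Ext.comp_zero]
    exact one_ne_zero (((e.apply_symm_apply 1).symm.trans (congrArg e (h0 _))).trans (map_zero e))
  have : Module.Finite A ω := hfin
  exact ⟨d, hd, h1, h2, fun i hi ↦ subsingleton_ext_of_isWeaklyRegular_quotient hs hm
    hreg.toIsWeaklyRegular (by omega), fun i hi ↦
    subsingleton_ext_of_subsingleton_ext_quotient hs (fun i hi ↦ h2 i hi.ne) hi⟩

lemma subsingleton_ext_prod {R : Type u} [CommRing R] {M N K : Type u} [AddCommGroup M] [Module R M]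
    [AddCommGroup N] [Module R N] [AddCommGroup K] [Module R K] {i : ℕ}
    (hM : Subsingleton (ExtMod R K M i)) (hN : Subsingleton (ExtMod R K N i)) :
    Subsingleton (ExtMod R K (M × N) i) :=
  subsingleton_ext_post_mid LinearMap.inl_injective .inl_snd LinearMap.snd_surjective hM hN

include hs₁ hs₂ hi₁ hi₂ hex₁ hex₂

/-- A Noetherian local ring that is a double extension of two Cohen–Macaulay quotients by their
dualizing modules is Gorenstein. -/
theorem isGorensteinLocal_of_doubleExtension [IsNoetherianRing R]
    (hCM₁ : IsCohenMacaulayLocal A₁) (hCM₂ : IsCohenMacaulayLocal A₂)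
    (hω₁ : IsDualizingModule A₁ (ModuleCat.of A₁ ω₁))
    (hω₂ : IsDualizingModule A₂ (ModuleCat.of A₂ ω₂)) : IsGorensteinLocal R := by
  have := hCM₁.1
  have := hCM₂.1
  have hf₁ : Module.Finite A₁ ω₁ := hω₁.1
  have hf₂ : Module.Finite A₂ ω₂ := hω₂.1
  have hfA₁ : Module.Finite R A₁ := .of_surjective (Algebra.linearMap R A₁) hs₁
  have hfA₂ : Module.Finite R A₂ := .of_surjective (Algebra.linearMap R A₂) hs₂
  have hfω₁ : Module.Finite R ω₁ := .trans A₁ ω₁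
  have hfω₂ : Module.Finite R ω₂ := .trans A₂ ω₂
  obtain ⟨d₁, hd₁, h1, h2, hA₁, hω₁⟩ := depth_of_isDualizingModule (R := R) hs₁ hCM₁ hω₁
  obtain ⟨d₂, hd₂, h3, h4, hA₂, hω₂⟩ := depth_of_isDualizingModule (R := R) hs₂ hCM₂ hω₂
  let P := R × (A₁ × A₂) × (ω₁ × ω₂)
  -- the product `P` has depth at least `min d₁ d₂`, which gives a common regular sequence for all
  -- five modules
  have hP : ∀ i < min d₁ d₂, Subsingleton (ExtMod R (ResidueField R) P i) := fun i hi ↦ by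
    have ⟨hi1, hi2⟩ := lt_min_iff.1 hi
    refine subsingleton_ext_prod ?_ (subsingleton_ext_prod (subsingleton_ext_prod (hA₁ i hi1)
      (hA₂ i hi2)) (subsingleton_ext_prod (hω₁ i hi1) (hω₂ i hi2)))
    exact subsingleton_ext_post_mid (f := i₂) (g := Algebra.linearMap R A₁) hi₂ hex₂ hs₁
      (hω₂ i hi2) (hA₁ i hi1)
  have hlt : maximalIdeal R • (⊤ : Submodule R P) < ⊤ :=
    lt_top_iff_ne_top.2 (Submodule.top_ne_ideal_smul_of_le_jacobson_annihilator
      (maximalIdeal_le_jacobson _)).symm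
  have hsupp : Module.support R (R ⧸ maximalIdeal R) =
      PrimeSpectrum.zeroLocus (maximalIdeal R) := by
    rw [Module.support_eq_zeroLocus, Ideal.annihilator_quotient]
  obtain ⟨rs, hl, hm, hreg⟩ := ModuleCat.exists_isRegular_of_exists_subsingleton_ext
    (maximalIdeal R) _ (ModuleCat.of R P) hlt (ModuleCat.of R (R ⧸ maximalIdeal R)) hsupp hP
  have hregP : IsWeaklyRegular P rs := hreg.toIsWeaklyRegular
  have hrR : IsWeaklyRegular R rs := isWeaklyRegular_of_retract hregP (.inl _ _ _) (.fst _ _ _) rfl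
  have hr := isWeaklyRegular_of_retract hregP (.inr _ _ _) (.snd _ _ _) rfl
  have hrA := isWeaklyRegular_of_retract hr (.inl _ _ _) (.fst _ _ _) rfl
  have hrω := isWeaklyRegular_of_retract hr (.inr _ _ _) (.snd _ _ _) rfl
  have hrA₁ := isWeaklyRegular_of_retract hrA (.inl _ _ _) (.fst _ _ _) rfl
  have hrA₂ := isWeaklyRegular_of_retract hrA (.inr _ _ _) (.snd _ _ _) rfl
  have hrω₁ := isWeaklyRegular_of_retract hrω (.inl _ _ _) (.fst _ _ _) rfl
  have hrω₂ := isWeaklyRegular_of_retract hrω (.inr _ _ _) (.snd _ _ _) rfl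
  rcases lt_trichotomy d₁ d₂ with hlt | rfl | hlt
  · rw [min_eq_left hlt.le] at hl
    subst hl
    exact (false_of_subsingleton_ext_residueField hs₁ hs₂ hi₁ hi₂ hex₁ hex₂ hm hrA₁ hrA₂
      hrω₁ hrω₂ hd₁ h1 h2
      (h4 _ hlt.ne)).elim
  · rw [min_self] at hl
    subst hl
    exact isGorensteinLocal_of_ringKrullDim_eq hs₁ hs₂ hi₁ hi₂ hex₁ hex₂ hm hrA₁ hrA₂
      hrω₁ hrω₂ hd₁ h1 hrR hd₂ h3 h4
  · rw [min_eq_right hlt.le] at hl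
    subst hl
    exact (false_of_subsingleton_ext_residueField hs₂ hs₁ hi₂ hi₁ hex₂ hex₁ hm hrA₂ hrA₁
      hrω₂ hrω₁ hd₂ h3 h4
      (h2 _ hlt.ne)).elim

end LocalLinkage

/-! ### Sections of the tensor product of sheaves -/

section TensorSections

open Opposite Scheme.Modules

variable {X : Scheme.{u}}

/-- The canonical map on sections from the presheaf tensor product to the tensor product. -/
noncomputable def toTensor (M N : X.Modules) (U : X.Opens) :
    (presheafTensor M N).obj (op U) →ₗ[Γ(X, U)] Γ(tensor M N, U) :=
  (((PresheafOfModules.sheafificationAdjunction (𝟙 X.ringCatSheaf.obj)).unit.app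
    (presheafTensor M N)).app (op U)).hom

lemma toTensor_map (M N : X.Modules) {U V : X.Opens} (i : U ⟶ V)
    (t : (presheafTensor M N).obj (op V)) :
    (tensor M N).presheaf.map i.op (toTensor M N V t) =
      toTensor M N U ((presheafTensor M N).presheaf.map i.op t) :=
  (CategoryTheory.NatTrans.naturality_apply (CategoryTheory.toSheafify
    (Opens.grothendieckTopology X) (presheafTensor M N).presheaf) i.op t).symm

lemma toTensor_locally_injective (M N : X.Modules) {U : X.Opens}
    (t : (presheafTensor M N).obj (op U)) (ht : toTensor M N U t = 0) {x : X} (hx : x ∈ U) :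
    ∃ (V : X.Opens) (i : V ⟶ U), x ∈ V ∧ (presheafTensor M N).presheaf.map i.op t = 0 := by
  obtain ⟨V, i, h, hxV⟩ := Presheaf.equalizerSieve_mem (Opens.grothendieckTopology X)
    (CategoryTheory.toSheafify (Opens.grothendieckTopology X) (presheafTensor M N).presheaf)
    t 0 (ht.trans (map_zero (toTensor M N U)).symm) x hx
  exact ⟨V, i, hxV, h.trans (map_zero _)⟩

lemma toTensor_locally_surjective (M N : X.Modules) {U : X.Opens}
    (s : Γ(tensor M N, U)) {x : X} (hx : x ∈ U) :
    ∃ (V : X.Opens) (i : V ⟶ U), x ∈ V ∧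
      ∃ t, toTensor M N V t = (tensor M N).presheaf.map i.op s := by
  obtain ⟨V, i, h, hxV⟩ := Presheaf.imageSieve_mem (Opens.grothendieckTopology X)
    (CategoryTheory.toSheafify (Opens.grothendieckTopology X) (presheafTensor M N).presheaf)
    s x hx
  exact ⟨V, i, hxV, h⟩

/-- The section `m ⊗ n` of the presheaf tensor product. -/
def tmulPre (M N : X.Modules) {U : X.Opens} (m : Γ(M, U)) (n : Γ(N, U)) :
    (presheafTensor M N).obj (op U) :=
  let a : (toPresheafOfModules M).obj (op U) := m
  let b : (toPresheafOfModules N).obj (op U) := n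
  (a ⊗ₜ[Γ(X, U)] b)

lemma map_tmulPre (M N : X.Modules) {U V : X.Opens} (i : U ⟶ V) (m : Γ(M, V)) (n : Γ(N, V)) :
    (presheafTensor M N).presheaf.map i.op (tmulPre M N m n) =
      tmulPre M N (M.presheaf.map i.op m) (N.presheaf.map i.op n) :=
  PresheafOfModules.Monoidal.tensorObj_map_tmul i.op _ _

/-- The map `m ↦ m ⊗ n` into the presheaf tensor product, linear in `m`. -/
noncomputable def tmulPreHom (M N : X.Modules) {U : X.Opens} (n : Γ(N, U)) :
    Γ(M, U) →ₗ[Γ(X, U)] (presheafTensor M N).obj (op U) :=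
  (TensorProduct.mk Γ(X, U) Γ(M, U) Γ(N, U)).flip n

lemma tmulPreHom_bijective (M N : X.Modules) {U : X.Opens} (n : Γ(N, U))
    (h : Function.Bijective fun a : Γ(X, U) ↦ a • n) : Function.Bijective (tmulPreHom M N n) := by
  let e : Γ(X, U) ≃ₗ[Γ(X, U)] Γ(N, U) := LinearEquiv.ofBijective (LinearMap.toSpanSingleton _ _ n) h
  let E : Γ(M, U) ≃ₗ[Γ(X, U)] TensorProduct Γ(X, U) Γ(M, U) Γ(N, U) :=
    (TensorProduct.rid Γ(X, U) Γ(M, U)).symm.trans (TensorProduct.congr (LinearEquiv.refl _ _) e)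
  have : ∀ m, tmulPreHom M N n m = E m := fun m ↦ by
    have h1 : e 1 = n := one_smul Γ(X, U) n
    simp only [E, LinearEquiv.trans_apply, TensorProduct.rid_symm_apply,
      TensorProduct.congr_tmul, LinearEquiv.refl_apply, h1]
    rfl
  exact (funext this : ⇑(tmulPreHom M N n) = E) ▸ E.bijective

end TensorSections

/-! ### Stalks of sheaves of modules -/

section Stalks

open Opposite Scheme.Modules

variable {X : Scheme.{u}}

/-- An invertible module has a local generator `e` near every point: over all smaller open sets,
multiplication by `e` is a bijection from functions to sections. -/
lemma exists_generator_of_isInvertible {L : X.Modules} (hL : IsInvertible L) (x : X) :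
    ∃ (W : X.Opens) (e : Γ(L, W)), x ∈ W ∧ ∀ (V : X.Opens) (i : V ⟶ W),
      Function.Bijective fun a : Γ(X, V) ↦ a • L.presheaf.map i.op e := by
  obtain ⟨U, hx, ⟨φ⟩⟩ := hL x
  refine ⟨U.ι ''ᵁ ⊤, (restrictAppIso U.ι L ⊤).hom (φ.inv.app ⊤ (1 : Γ(U, ⊤))), by simpa, ?_⟩
  intro V i
  obtain ⟨V', rfl⟩ : ∃ V', U.ι ''ᵁ V' = V := ⟨U.ι ⁻¹ᵁ V, by
    rw [Scheme.Hom.image_preimage_eq_opensRange_inf]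
    simpa using i.le⟩
  have key : ∀ a : Γ(U, V'), φ.inv.app V' a =
      (U.ι.appIso V').inv a • L.presheaf.map i.op
        ((restrictAppIso U.ι L ⊤).hom (φ.inv.app ⊤ (1 : Γ(U, ⊤)))) := by
    intro a
    have h1 : φ.inv.app V' (a • (1 : Γ(U, V'))) =
        a • φ.inv.app V' (1 : Γ(U, V')) := Hom.app_smul φ.inv a (1 : Γ(U, V'))
    have h2 : φ.inv.app V' ((structureSheaf (U : Scheme.{u})).presheaf.map
          (homOfLE (le_top : V' ≤ ⊤)).op (1 : Γ(U, ⊤))) =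
        (L.restrict U.ι).presheaf.map (homOfLE (le_top : V' ≤ ⊤)).op
          (φ.inv.app ⊤ (1 : Γ(U, ⊤))) :=
      CategoryTheory.NatTrans.naturality_apply φ.inv.mapPresheaf _ _
    have h3 : (structureSheaf (U : Scheme.{u})).presheaf.map
          (homOfLE (le_top : V' ≤ ⊤)).op (1 : Γ(U, ⊤)) = (1 : Γ(U, V')) :=
      map_one (U.toScheme.presheaf.map (homOfLE (le_top : V' ≤ ⊤)).op).hom
    rw [h3] at h2
    rw [h2] at h1
    have h4 : a • (1 : Γ(U, V')) = a := mul_one a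
    rw [h4] at h1
    exact h1
  have hφ : Function.Bijective (φ.inv.app V') := ConcreteCategory.bijective_of_isIso _
  have hi : Function.Bijective (U.ι.appIso V').hom := ConcreteCategory.bijective_of_isIso _
  convert! hφ.comp hi using 1
  ext a
  exact .trans (by simp; rfl) (key ((U.ι.appIso V').hom a)).symm

lemma map_map_apply (F : TopCat.Presheaf AddCommGrpCat.{u} X) {U V W : X.Opens} (i : U ⟶ V)
    (j : V ⟶ W) (k : U ⟶ W) (s : F.obj (op W)) : F.map i.op (F.map j.op s) = F.map k.op s := by
  rw [← ConcreteCategory.comp_apply, ← F.map_comp]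
  rfl

/-- The germ at `x` of a section of an `𝒪_X`-module, as an element of the `𝒪_{X,x}`-module
`stalk M x`. -/
noncomputable def stalkGerm (M : X.Modules) (U : X.Opens) (x : X) (hx : x ∈ U) :
    Γ(M, U) →+ stalk M x :=
  (M.presheaf.germ U x hx).hom

lemma stalkGerm_map (M : X.Modules) {U V : X.Opens} (i : U ⟶ V) (x : X) (hx : x ∈ U)
    (s : Γ(M, V)) :
    stalkGerm M U x hx (M.presheaf.map i.op s) = stalkGerm M V x (i.le hx) s :=
  M.presheaf.germ_res_apply i x hx s

lemma exists_stalkGerm_eq (M : X.Modules) {x : X} (m : stalk M x) {V : X.Opens} (hV : x ∈ V) :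
    ∃ (U : X.Opens) (_ : U ⟶ V) (hx : x ∈ U) (s : Γ(M, U)), stalkGerm M U x hx s = m := by
  obtain ⟨U, hUV, hx, s, h⟩ := M.presheaf.exists_le_germ_eq m hV
  exact ⟨U, homOfLE hUV, hx, s, h⟩

lemma exists_map_eq_zero_of_stalkGerm_eq_zero (M : X.Modules) {x : X} {U : X.Opens} (hx : x ∈ U)
    (s : Γ(M, U)) (h : stalkGerm M U x hx s = 0) :
    ∃ (V : X.Opens) (i : V ⟶ U), x ∈ V ∧ M.presheaf.map i.op s = 0 := by
  obtain ⟨V, hxV, i, j, e⟩ := M.presheaf.germ_eq x hx hx s 0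
    (h.trans (map_zero (stalkGerm M U x hx)).symm)
  exact ⟨V, i, hxV, e.trans (map_zero _)⟩

lemma stalkGerm_smul (M : X.Modules) (U : X.Opens) (x : X) (hx : x ∈ U) (r : Γ(X, U))
    (m : Γ(M, U)) :
    stalkGerm M U x hx (r • m) = X.presheaf.germ U x hx r • stalkGerm M U x hx m :=
  PresheafOfModules.germ_smul (R := X.presheaf) (toPresheafOfModules M) x U hx r m

/-- The additive map out of the stalk `M_x` induced by a compatible family of additive maps out of
the groups of sections over the open neighbourhoods of `x`. -/
noncomputable def stalkDesc (M : X.Modules) (x : X) {A : Type u} [AddCommGroup A]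
    (f : ∀ U : X.Opens, x ∈ U → Γ(M, U) →+ A)
    (hf : ∀ (U V : X.Opens) (i : U ⟶ V) (hx : x ∈ U) (s : Γ(M, V)),
      f U hx (M.presheaf.map i.op s) = f V (i.le hx) s) : stalk M x →+ A :=
  AddCommGrpCat.Hom.hom (X := M.presheaf.stalk x) (Y := AddCommGrpCat.of A) <|
    Limits.colimit.desc ((OpenNhds.inclusion x).op ⋙ M.presheaf)
    { pt := AddCommGrpCat.of A
      ι :=
        { app := fun U ↦ AddCommGrpCat.ofHom (f U.unop.1 U.unop.2)
          naturality := fun U V i ↦ by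
            ext s
            exact hf _ _ (homOfLE (leOfHom i.unop)) V.unop.2 s } }

lemma stalkDesc_stalkGerm (M : X.Modules) (x : X) {A : Type u} [AddCommGroup A]
    (f : ∀ U : X.Opens, x ∈ U → Γ(M, U) →+ A)
    (hf : ∀ (U V : X.Opens) (i : U ⟶ V) (hx : x ∈ U) (s : Γ(M, V)),
      f U hx (M.presheaf.map i.op s) = f V (i.le hx) s) (U : X.Opens) (hx : x ∈ U) (s : Γ(M, U)) :
    stalkDesc M x f hf (stalkGerm M U x hx s) = f U hx s :=
  ConcreteCategory.congr_hom (Limits.colimit.ι_desc (F := (OpenNhds.inclusion x).op ⋙ M.presheaf)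
    { pt := AddCommGrpCat.of A
      ι :=
        { app := fun U ↦ AddCommGrpCat.ofHom (f U.unop.1 U.unop.2)
          naturality := fun U V i ↦ by
            ext s
            exact hf _ _ (homOfLE (leOfHom i.unop)) V.unop.2 s } } (op ⟨U, hx⟩)) s

section Twist

variable {M L : X.Modules} {W : X.Opens} (e : Γ(L, W))

/-- The map `m ↦ m ⊗ e` from sections of `M` to sections of `M ⊗ L`, over an open set `U` contained
in the domain `W` of `e`. -/
noncomputable def tensorSection (U : X.Opens) (i : U ⟶ W) :
    Γ(M, U) →ₗ[Γ(X, U)] Γ(tensor M L, U) :=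
  toTensor M L U ∘ₗ tmulPreHom M L (L.presheaf.map i.op e)

lemma map_tmulPreHom {U V : X.Opens} (i : U ⟶ W) (j : V ⟶ W) (k : V ⟶ U) (m : Γ(M, U)) :
    (presheafTensor M L).presheaf.map k.op (tmulPreHom M L (L.presheaf.map i.op e) m) =
      tmulPreHom M L (L.presheaf.map j.op e) (M.presheaf.map k.op m) := by
  refine (map_tmulPre M L k m (L.presheaf.map i.op e)).trans ?_
  rw [map_map_apply L.presheaf k i j]
  rfl

lemma map_tensorSection {U V : X.Opens} (i : U ⟶ W) (j : V ⟶ W) (k : V ⟶ U) (m : Γ(M, U)) :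
    (tensor M L).presheaf.map k.op (tensorSection e U i m) =
      tensorSection e V j (M.presheaf.map k.op m) :=
  (toTensor_map M L k _).trans (congrArg (toTensor M L V) (map_tmulPreHom e i j k m))

/-- The map `m ↦ m ⊗ e` on stalks at a point `x` of the domain of `e`. -/
noncomputable def twistStalk (M : X.Modules) {x : X} (hW : x ∈ W) :
    stalk M x →+ stalk (tensor M L) x :=
  stalkDesc M x
    (fun U hx ↦ (stalkGerm (tensor M L) (U ⊓ W) x ⟨hx, hW⟩).comp
      ((tensorSection e (U ⊓ W) (homOfLE inf_le_right)).toAddMonoidHom.comp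
        (M.presheaf.map (homOfLE inf_le_left : U ⊓ W ⟶ U).op).hom))
    (fun U V i hx s ↦ by
      let k : U ⊓ W ⟶ V ⊓ W := homOfLE (inf_le_inf_right _ i.le)
      refine .trans ?_ (stalkGerm_map (tensor M L) k x ⟨hx, hW⟩ _)
      refine congrArg (stalkGerm (tensor M L) (U ⊓ W) x ⟨hx, hW⟩) ?_
      refine .trans ?_ (map_tensorSection e (homOfLE inf_le_right) (homOfLE inf_le_right) k _).symm
      refine congrArg (tensorSection e (U ⊓ W) _) ?_
      exact (map_map_apply M.presheaf _ _ (homOfLE (inf_le_left.trans i.le)) s).trans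
        (map_map_apply M.presheaf _ _ _ s).symm)

lemma twistStalk_stalkGerm {x : X} (hW : x ∈ W) {U : X.Opens} (i : U ⟶ W) (hx : x ∈ U)
    (m : Γ(M, U)) :
    twistStalk e M hW (stalkGerm M U x hx m) =
      stalkGerm (tensor M L) U x hx (tensorSection e U i m) := by
  refine (stalkDesc_stalkGerm M x _ _ U hx m).trans ?_
  refine .trans ?_ (stalkGerm_map (tensor M L) (homOfLE inf_le_left : U ⊓ W ⟶ U) x ⟨hx, hW⟩ _)
  exact congrArg (stalkGerm (tensor M L) (U ⊓ W) x ⟨hx, hW⟩)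
    (map_tensorSection e i (homOfLE inf_le_right) _ m).symm

lemma twistStalk_smul {x : X} (hW : x ∈ W) (r : X.presheaf.stalk x) (m : stalk M x) :
    twistStalk e M hW (r • m) = r • twistStalk e M hW m := by
  obtain ⟨U, hUW, hx, r, rfl⟩ := X.presheaf.exists_le_germ_eq r hW
  obtain ⟨V, i, hxV, m, rfl⟩ := exists_stalkGerm_eq M m hx
  rw [← X.presheaf.germ_res_apply i x hxV, ← stalkGerm_smul,
    twistStalk_stalkGerm e hW (i ≫ homOfLE hUW), twistStalk_stalkGerm e hW (i ≫ homOfLE hUW),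
    _root_.map_smul, stalkGerm_smul]

lemma twistStalk_bijective {x : X} (hW : x ∈ W)
    (he : ∀ (V : X.Opens) (i : V ⟶ W),
      Function.Bijective fun a : Γ(X, V) ↦ a • L.presheaf.map i.op e) :
    Function.Bijective (twistStalk e M hW) := by
  constructor
  · rw [injective_iff_map_eq_zero]
    intro m hm
    obtain ⟨V, i, hxV, m, rfl⟩ := exists_stalkGerm_eq M m hW
    rw [twistStalk_stalkGerm e hW i hxV] at hm
    obtain ⟨V', k, hx', h⟩ := exists_map_eq_zero_of_stalkGerm_eq_zero _ _ _ hm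
    rw [map_tensorSection e i (k ≫ i)] at h
    obtain ⟨V'', k', hx'', h⟩ := toTensor_locally_injective M L _ h hx'
    rw [map_tmulPreHom e (k ≫ i) (k' ≫ k ≫ i)] at h
    have h0 := (injective_iff_map_eq_zero _).mp
      (tmulPreHom_bijective M L _ (he V'' (k' ≫ k ≫ i))).injective _ h
    rw [map_map_apply M.presheaf k' k (k' ≫ k)] at h0
    rw [← stalkGerm_map M (k' ≫ k) x hx'', h0, map_zero]
  · intro t
    obtain ⟨V, i, hxV, s, rfl⟩ := exists_stalkGerm_eq (tensor M L) t hW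
    obtain ⟨V', k, hx', t, ht⟩ := toTensor_locally_surjective M L s hxV
    obtain ⟨m, rfl⟩ := (tmulPreHom_bijective M L _ (he V' (k ≫ i))).surjective t
    refine ⟨stalkGerm M V' x hx' m, ?_⟩
    rw [twistStalk_stalkGerm e hW (k ≫ i) hx', ← stalkGerm_map (tensor M L) k x hx']
    exact congrArg _ ht

end Twist

/-- Tensoring with an invertible module does not change stalks, up to isomorphism. -/
lemma exists_stalk_tensor_equiv (M : X.Modules) {L : X.Modules} (hL : IsInvertible L) (x : X) :
    Nonempty (stalk M x ≃ₗ[X.presheaf.stalk x] stalk (tensor M L) x) := by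
  obtain ⟨W, e, hW, he⟩ := exists_generator_of_isInvertible hL x
  let f : stalk M x →ₗ[X.presheaf.stalk x] stalk (tensor M L) x :=
    { twistStalk e M hW with map_smul' := twistStalk_smul e hW }
  exact ⟨LinearEquiv.ofBijective f (twistStalk_bijective e hW he)⟩

end Stalks

/-! ### Kernels along closed immersions -/

section ClosedImmersions

open Opposite Scheme.Modules

variable {X Y : Scheme.{u}}

/-- The homomorphism `𝒪_{Y,y} ⟶ 𝒪_{X,x}` of local rings induced by `j : X ⟶ Y`, where `j x = y`. The
equality is kept as a hypothesis in order to compare the stalks at points of two different closed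
subschemes. -/
noncomputable def stalkHom (j : X ⟶ Y) {x : X} {y : Y} (h : j x = y) :
    Y.presheaf.stalk y →+* X.presheaf.stalk x :=
  ((Y.presheaf.stalkCongr (.of_eq h.symm)).hom ≫ j.stalkMap x).hom

lemma stalkHom_germ (j : X ⟶ Y) {x : X} {y : Y} (h : j x = y) (U : Y.Opens) (hy : y ∈ U)
    (s : Γ(Y, U)) :
    stalkHom j h (Y.presheaf.germ U y hy s) =
      X.presheaf.germ (j ⁻¹ᵁ U) x (show j x ∈ U from h ▸ hy) (j.app U s) := by
  subst h
  simp [stalkHom]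

lemma stalkHom_surjective (j : X ⟶ Y) [IsClosedImmersion j] {x : X} {y : Y} (h : j x = y) :
    Function.Surjective (stalkHom j h) := by
  subst h
  simpa [stalkHom] using j.stalkMap_surjective x

/-- The ideal of `𝒪_{Y,y}` of germs of sections of the kernel of `𝒪_Y ⟶ j_* 𝒪_X`, as a subset. -/
def kernelStalk (j : X ⟶ Y) (y : Y) : Set (Y.presheaf.stalk y) :=
  {a | ∃ (U : Y.Opens) (hy : y ∈ U) (s : Γ(Y, U)), Y.presheaf.germ U y hy s = a ∧ j.app U s = 0}

/-- At a point of `X`, the stalk of the kernel of `𝒪_Y ⟶ j_* 𝒪_X` is the kernel on stalks: every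
open neighbourhood of `x` contains the preimage of an open neighbourhood of `j x`. -/
lemma mem_kernelStalk_iff (j : X ⟶ Y) [IsClosedImmersion j] {x : X} {y : Y} (h : j x = y)
    (a : Y.presheaf.stalk y) : a ∈ kernelStalk j y ↔ stalkHom j h a = 0 := by
  constructor
  · rintro ⟨U, hy, s, rfl, hs⟩
    rw [stalkHom_germ, hs, map_zero]
  · intro ha
    obtain ⟨U, hy, s, rfl⟩ := Y.presheaf.exists_germ_eq a
    rw [stalkHom_germ] at ha
    obtain ⟨V, hxV, i, i', e⟩ := X.presheaf.germ_eq x _ (show x ∈ (⊤ : X.Opens) from trivial) _ 0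
      (ha.trans (map_zero _).symm)
    obtain ⟨W, hW, hWV⟩ := j.isClosedEmbedding.isInducing.isOpen_iff.mp V.2
    let W' : Y.Opens := ⟨W, hW⟩
    have hyW : y ∈ U ⊓ W' := ⟨hy, by
      rw [← h]; change x ∈ j ⁻¹' W; rw [hWV]; exact hxV⟩
    refine ⟨U ⊓ W', hyW, Y.presheaf.map (homOfLE inf_le_left).op s,
      Y.presheaf.germ_res_apply _ _ _ _, ?_⟩
    have hle : j ⁻¹ᵁ (U ⊓ W') ≤ V := fun z hz ↦ by
      change z ∈ V.carrier; rw [← hWV]; exact hz.2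
    have e2 : X.presheaf.map (homOfLE hle).op (X.presheaf.map i.op (j.app U s)) = 0 := by
      rw [e, map_zero, map_zero]
    rw [← ConcreteCategory.comp_apply, j.naturality, ConcreteCategory.comp_apply]
    rw [← ConcreteCategory.comp_apply, ← X.presheaf.map_comp] at e2
    exact e2

lemma exists_preimage_eq_bot (j : X ⟶ Y) [IsClosedImmersion j] {y : Y} (hy : y ∉ Set.range j)
    {U : Y.Opens} (hU : y ∈ U) : ∃ (V : Y.Opens) (_ : V ⟶ U), y ∈ V ∧ j ⁻¹ᵁ V = ⊥ := by
  let C : Y.Opens := ⟨(Set.range j)ᶜ, j.isClosedEmbedding.isClosed_range.isOpen_compl⟩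
  refine ⟨U ⊓ C, homOfLE inf_le_left, ⟨hU, hy⟩, ?_⟩
  ext z
  simp [C]

lemma subsingleton_sections_of_eq_bot (F : X.Modules) {U : X.Opens} (hU : U = ⊥) :
    Subsingleton Γ(F, U) := by
  subst hU
  exact Module.subsingleton Γ(X, ⊥) _

/-- Outside the closed set `X`, the sheaf `j_* 𝒪_X` vanishes, so every germ is in the kernel. -/
lemma kernelStalk_eq_univ (j : X ⟶ Y) [IsClosedImmersion j] {y : Y} (hy : y ∉ Set.range j) :
    kernelStalk j y = Set.univ := by
  refine Set.eq_univ_of_forall fun a ↦ ?_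
  obtain ⟨U, hU, s, rfl⟩ := Y.presheaf.exists_germ_eq a
  obtain ⟨V, i, hV, h⟩ := exists_preimage_eq_bot j hy hU
  have : Subsingleton Γ(X, j ⁻¹ᵁ V) := subsingleton_sections_of_eq_bot (structureSheaf X) h
  exact ⟨V, hV, Y.presheaf.map i.op s, Y.presheaf.germ_res_apply _ _ _ _, Subsingleton.elim _ _⟩

/-- Sections over an open set form a left exact functor. -/
lemma injective_and_exact_app {S : ShortComplex Y.Modules} (hS : S.ShortExact) (U : Y.Opens) :
    Function.Injective (S.f.app U) ∧ ∀ s : Γ(S.X₂, U), S.g.app U s = 0 → ∃ t, S.f.app U t = s := by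
  have := hS.mono_f
  let E : Y.Modules ⥤ _ := SheafOfModules.evaluation Y.ringCatSheaf (op U)
  have : Limits.PreservesFiniteLimits E :=
    inferInstanceAs (Limits.PreservesFiniteLimits
      (SheafOfModules.evaluation Y.ringCatSheaf (op U)))
  have : E.PreservesZeroMorphisms := ⟨fun _ _ ↦ rfl⟩
  exact ⟨(ModuleCat.mono_iff_injective (E.map S.f)).mp inferInstance,
    (ShortComplex.moduleCat_exact_iff _).mp
      (hS.exact.map_of_mono_of_preservesKernel E hS.mono_f inferInstance)⟩

section Kernel

variable {X' : Scheme.{u}} {j : X ⟶ Y} {j' : X' ⟶ Y} {F : X.Modules}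
  {i : (pushforward j).obj F ⟶ structureSheaf Y} {w : i ≫ structureMap j' = 0}
  (hS : (ShortComplex.mk i (structureMap j') w).ShortExact)

include w in
lemma app_app_eq_zero (U : Y.Opens) (t : Γ(F, j ⁻¹ᵁ U)) :
    j'.app U (show Γ(Y, U) from i.app U t) = 0 :=
  congr($(congrArg (fun f : (pushforward j).obj F ⟶ _ ↦ Hom.app f U) w) t)

include hS in
/-- If `j_* F` is the kernel of `𝒪_Y ⟶ j'_* 𝒪_{X'}`, that kernel has zero stalk outside `X`. -/
lemma kernelStalk_eq_zero [IsClosedImmersion j] {y : Y} (hy : y ∉ Set.range j) :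
    kernelStalk j' y ⊆ {0} := by
  rintro _ ⟨U, hU, s, rfl, hs⟩
  obtain ⟨V, k, hV, h⟩ := exists_preimage_eq_bot j hy hU
  obtain ⟨t, rfl⟩ := (injective_and_exact_app hS U).2 s hs
  have := subsingleton_sections_of_eq_bot F h
  have h1 : i.app V (((pushforward j).obj F).presheaf.map k.op t) =
      (structureSheaf Y).presheaf.map k.op (i.app U t) :=
    CategoryTheory.NatTrans.naturality_apply i.mapPresheaf k.op t
  have h2 : ((pushforward j).obj F).presheaf.map k.op t = 0 :=
    Subsingleton.elim (α := Γ(F, j ⁻¹ᵁ V)) _ _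
  rw [h2, map_zero] at h1
  rw [Set.mem_singleton_iff]
  refine (Y.presheaf.germ_res_apply k y hV _).symm.trans ?_
  exact (congrArg (Y.presheaf.germ V y hV) h1.symm).trans (map_zero _)

variable (i) in
/-- The map `(j_* F)_y ⟶ 𝒪_{Y,y}` induced by `i` on stalks. -/
noncomputable def pushforwardStalkMap (y : Y) :
    stalk ((pushforward j).obj F) y →+ Y.presheaf.stalk y :=
  stalkDesc _ y
    (fun U hU ↦ (Y.presheaf.germ U y hU).hom.toAddMonoidHom.comp
      (show Γ((pushforward j).obj F, U) →+ Γ(Y, U) from (i.app U).hom))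
    (fun U V k hy t ↦ by
      have h1 : i.app U (((pushforward j).obj F).presheaf.map k.op t) =
          (structureSheaf Y).presheaf.map k.op (i.app V t) :=
        CategoryTheory.NatTrans.naturality_apply i.mapPresheaf k.op t
      exact (congrArg (Y.presheaf.germ U y hy) h1).trans (Y.presheaf.germ_res_apply k y hy _))

lemma pushforwardStalkMap_stalkGerm (y : Y) (U : Y.Opens) (hU : y ∈ U)
    (t : Γ((pushforward j).obj F, U)) :
    pushforwardStalkMap i y (stalkGerm _ U y hU t) =
      Y.presheaf.germ U y hU (show Γ(Y, U) from i.app U t) :=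
  stalkDesc_stalkGerm _ y _ _ U hU t

include hS in
lemma pushforwardStalkMap_injective (y : Y) : Function.Injective (pushforwardStalkMap i y) := by
  rw [injective_iff_map_eq_zero]
  intro t ht
  obtain ⟨U, -, hU, t, rfl⟩ := exists_stalkGerm_eq _ t (show y ∈ (⊤ : Y.Opens) from trivial)
  rw [pushforwardStalkMap_stalkGerm] at ht
  obtain ⟨V, hV, k, k', h⟩ := Y.presheaf.germ_eq y hU hU _ 0 (ht.trans (map_zero _).symm)
  rw [map_zero (Y.presheaf.map k'.op).hom] at h
  have h1 : i.app V (((pushforward j).obj F).presheaf.map k.op t) =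
      (structureSheaf Y).presheaf.map k.op (i.app U t) :=
    CategoryTheory.NatTrans.naturality_apply i.mapPresheaf k.op t
  have h2 := (injective_and_exact_app hS V).1 (h1.trans (h.trans (map_zero (i.app V).hom).symm))
  rw [← stalkGerm_map _ k y hV]
  exact (congrArg _ h2).trans (map_zero _)

include hS in
lemma range_pushforwardStalkMap (y : Y) :
    Set.range (pushforwardStalkMap i y) = kernelStalk j' y := by
  apply Set.Subset.antisymm
  · rintro _ ⟨t, rfl⟩
    obtain ⟨U, -, hU, t, rfl⟩ := exists_stalkGerm_eq _ t (show y ∈ (⊤ : Y.Opens) from trivial)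
    exact ⟨U, hU, _, (pushforwardStalkMap_stalkGerm y U hU t).symm, app_app_eq_zero (w := w) U t⟩
  · rintro _ ⟨U, hU, s, rfl, hs⟩
    obtain ⟨t, rfl⟩ := (injective_and_exact_app hS U).2 s hs
    exact ⟨_, pushforwardStalkMap_stalkGerm y U hU t⟩

/-- The identification of the stalks of `F` and `j_* F` at a point of a closed subscheme. -/
lemma exists_pushforwardStalk_equiv (j : X ⟶ Y) [IsClosedImmersion j] (F : X.Modules) (x : X) :
    ∃ e : stalk ((pushforward j).obj F) (j x) ≃+ stalk F x,
      ∀ (U : Y.Opens) (hx : j x ∈ U) (t : Γ((pushforward j).obj F, U)),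
        e (stalkGerm _ U (j x) hx t) = stalkGerm F (j ⁻¹ᵁ U) x hx t := by
  have := TopCat.Presheaf.stalkPushforward.stalkPushforward_iso_of_isInducing Ab
    (f := j.base) j.isClosedEmbedding.isInducing F.presheaf x
  exact ⟨(asIso
    (TopCat.Presheaf.stalkPushforward _ j.base F.presheaf x)).addCommGroupIsoToAddEquiv,
    fun U hx t ↦ TopCat.Presheaf.stalkPushforward_germ_apply _ j.base F.presheaf U x hx t⟩

include hS in
/-- The exact sequence `0 ⟶ j_* F ⟶ 𝒪_Y ⟶ j'_* 𝒪_{X'}` on stalks at a point `y = j x`: it embeds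
`F_x` into `𝒪_{Y,y}`, compatibly with `𝒪_{Y,y} ⟶ 𝒪_{X,x}`. -/
lemma exists_stalk_to_stalk [IsClosedImmersion j] {x : X} {y : Y} (h : j x = y) :
    ∃ β : stalk F x →+ Y.presheaf.stalk y, Function.Injective β ∧
      (∀ a m, β (stalkHom j h a • m) = a * β m) ∧ Set.range β = kernelStalk j' y := by
  subst h
  obtain ⟨e, he⟩ := exists_pushforwardStalk_equiv j F x
  refine ⟨(pushforwardStalkMap i (j x)).comp e.symm.toAddMonoidHom,
    (pushforwardStalkMap_injective hS _).comp e.symm.injective, fun a m ↦ ?_, ?_⟩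
  · obtain ⟨t, rfl⟩ := e.surjective m
    obtain ⟨U, hU, a, rfl⟩ := Y.presheaf.exists_germ_eq a
    obtain ⟨V, k, hV, t, rfl⟩ := exists_stalkGerm_eq _ t hU
    rw [← Y.presheaf.germ_res_apply k (j x) hV]
    set b := Y.presheaf.map k.op a
    have h1 : stalkHom j rfl (Y.presheaf.germ V (j x) hV b) • e (stalkGerm _ V (j x) hV t) =
        e (stalkGerm _ V (j x) hV (b • t)) := by
      rw [stalkHom_germ, he, he]
      exact (stalkGerm_smul F (j ⁻¹ᵁ V) x hV (j.app V b) t).symm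
    rw [h1]
    simp only [AddMonoidHom.comp_apply, AddEquiv.toAddMonoidHom_eq_coe, AddMonoidHom.coe_coe,
      AddEquiv.symm_apply_apply, pushforwardStalkMap_stalkGerm]
    exact (congrArg (Y.presheaf.germ V (j x) hV) (Hom.app_smul i b t)).trans
      (map_mul (Y.presheaf.germ V (j x) hV).hom b _)
  · rw [← range_pushforwardStalkMap hS]
    exact e.symm.surjective.range_comp _

end Kernel

end ClosedImmersions

/-! ### The local rings of a linkage extension -/

/-- The variant of `isGorensteinLocal_of_doubleExtension` in which the module structures over `R`
are those given by restriction of scalars along explicit homomorphisms. -/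
lemma isGorensteinLocal_of_doubleExtension_ringHom {R A₁ A₂ : Type u} [CommRing R] [IsLocalRing R]
    [IsNoetherianRing R] [CommRing A₁] [IsLocalRing A₁] [CommRing A₂] [IsLocalRing A₂]
    {f₁ : R →+* A₁} {f₂ : R →+* A₂} (hf₁ : Function.Surjective f₁) (hf₂ : Function.Surjective f₂)
    {ω₁ : ModuleCat.{u} A₁} {ω₂ : ModuleCat.{u} A₂} {β₁ : ω₁ →+ R} {β₂ : ω₂ →+ R}
    (hβ₁ : Function.Injective β₁) (hβ₂ : Function.Injective β₂)
    (hsmul₁ : ∀ a m, β₁ (f₁ a • m) = a * β₁ m) (hsmul₂ : ∀ a m, β₂ (f₂ a • m) = a * β₂ m)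
    (hex₁ : ∀ a, f₂ a = 0 ↔ a ∈ Set.range β₁) (hex₂ : ∀ a, f₁ a = 0 ↔ a ∈ Set.range β₂)
    (hCM₁ : IsCohenMacaulayLocal A₁) (hCM₂ : IsCohenMacaulayLocal A₂)
    (hω₁ : IsDualizingModule A₁ ω₁) (hω₂ : IsDualizingModule A₂ ω₂) : IsGorensteinLocal R := by
  algebraize [f₁, f₂]
  let : Module R ω₁ := .compHom _ f₁
  let : Module R ω₂ := .compHom _ f₂
  have : IsScalarTower R A₁ ω₁ := .of_algebraMap_smul fun _ _ ↦ rfl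
  have : IsScalarTower R A₂ ω₂ := .of_algebraMap_smul fun _ _ ↦ rfl
  let b₁ : ω₁ →ₗ[R] R := { β₁ with map_smul' := hsmul₁ }
  let b₂ : ω₂ →ₗ[R] R := { β₂ with map_smul' := hsmul₂ }
  exact isGorensteinLocal_of_doubleExtension (A₁ := A₁) (A₂ := A₂) (i₁ := b₁) (i₂ := b₂)
    hf₁ hf₂ hβ₁ hβ₂ hex₁ hex₂ hCM₁ hCM₂ hω₁ hω₂

section OneSided

attribute [local instance] RingHomInvPair.of_ringEquiv

/-- A Noetherian local ring that is isomorphic to a dualizing module is Gorenstein. The isomorphism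
is semilinear along an isomorphism of local rings. -/
lemma isGorensteinLocal_of_bijective {R A : Type u} [CommRing R] [IsLocalRing R]
    [IsNoetherianRing R] [CommRing A] [IsLocalRing A] (f : R →+* A) (hf : Function.Bijective f)
    {ω : ModuleCat.{u} A} (hω : IsDualizingModule A ω) (β : ω →+ R) (hβ : Function.Bijective β)
    (hfβ : ∀ a m, β (f a • m) = a * β m) : IsGorensteinLocal R := by
  let e : R ≃+* A := .ofBijective f hf
  have : IsNoetherianRing A := isNoetherianRing_of_ringEquiv R e
  obtain ⟨hfin, d, -, -, hext⟩ := hω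
  have h := hasInjectiveDimensionLE_of_ext_residueField (R := A) (M := ω) (n := d)
    fun i hi ↦ hext i hi.ne'
  let s : ω ≃ₛₗ[RingHomClass.toRingHom e.symm] R :=
    { AddEquiv.ofBijective β hβ with
      map_smul' := fun a m ↦ by
        obtain ⟨r, rfl⟩ := e.surjective a
        have h1 : RingHomClass.toRingHom e.symm (e r) = r := e.symm_apply_apply r
        rw [h1]
        exact hfβ r m }
  exact ⟨inferInstance, d, (ModuleCat.hasInjectiveDimensionLE_iff_of_semiLinearEquiv e.symm
    (M := ModuleCat.of A ω) (N := ModuleCat.of R R) s d).mp h⟩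

end OneSided

section Points

open Scheme.Modules

variable {X₁ X₂ Y : Scheme.{u}} {j₁ : X₁ ⟶ Y} {j₂ : X₂ ⟶ Y} [IsClosedImmersion j₁]

/-- The embedding of `exists_stalk_to_stalk` for `F = ω ⊗ L`, with the stalk of `ω ⊗ L` replaced by
the isomorphic stalk of `ω`. -/
lemma exists_dualizing_to_stalk {ω L : X₁.Modules} (hL : IsInvertible L)
    {i : (pushforward j₁).obj (tensor ω L) ⟶ structureSheaf Y} {w : i ≫ structureMap j₂ = 0}
    (hS : (ShortComplex.mk i (structureMap j₂) w).ShortExact) {x : X₁} {y : Y} (h : j₁ x = y) :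
    ∃ β : stalk ω x →+ Y.presheaf.stalk y, Function.Injective β ∧
      (∀ a m, β (stalkHom j₁ h a • m) = a * β m) ∧ Set.range β = kernelStalk j₂ y := by
  obtain ⟨β, hβ, hsmul, hrange⟩ := exists_stalk_to_stalk hS h
  obtain ⟨e⟩ := exists_stalk_tensor_equiv ω hL x
  refine ⟨β.comp e.toLinearMap.toAddMonoidHom, hβ.comp e.injective, fun a m ↦ ?_, ?_⟩
  · exact (congrArg β (e.map_smul _ m)).trans (hsmul a (e m))
  · rw [← hrange]
    exact e.surjective.range_comp _

variable [IsClosedImmersion j₂] [IsLocallyNoetherian Y]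

/-- At a point of `X₁` outside `X₂` the two sequences give isomorphisms `𝒪_Y ≅ 𝒪_{X₁}` and
`ω₁ ⊗ L₁ ≅ 𝒪_Y` on stalks, so the local ring is its own dualizing module. -/
lemma isGorensteinLocal_stalk_of_notMem {ω₁ L₁ : X₁.Modules} {F₂ : X₂.Modules}
    (hω₁ : IsDualizingSheaf ω₁) (hL₁ : IsInvertible L₁)
    {i₁ : (pushforward j₁).obj (tensor ω₁ L₁) ⟶ structureSheaf Y} {w₁ : i₁ ≫ structureMap j₂ = 0}
    (h₁ : (ShortComplex.mk i₁ (structureMap j₂) w₁).ShortExact)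
    {i₂ : (pushforward j₂).obj F₂ ⟶ structureSheaf Y} {w₂ : i₂ ≫ structureMap j₁ = 0}
    (h₂ : (ShortComplex.mk i₂ (structureMap j₁) w₂).ShortExact)
    (x : X₁) (hx : j₁ x ∉ Set.range j₂) : IsGorensteinLocal (Y.presheaf.stalk (j₁ x)) := by
  obtain ⟨β, hβ, hsmul, hrange⟩ := exists_dualizing_to_stalk hL₁ h₁ (rfl : j₁ x = j₁ x)
  refine isGorensteinLocal_of_bijective (stalkHom j₁ rfl) ⟨?_, stalkHom_surjective j₁ rfl⟩
    (hω₁.2 x) β ⟨hβ, ?_⟩ hsmul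
  · rw [injective_iff_map_eq_zero]
    intro a ha
    exact kernelStalk_eq_zero h₂ hx ((mem_kernelStalk_iff j₁ rfl a).mpr ha)
  · rw [← Set.range_eq_univ, hrange, kernelStalk_eq_univ j₂ hx]

lemma isGorensteinLocal_stalk_of_mem {ω₁ L₁ : X₁.Modules} {ω₂ L₂ : X₂.Modules}
    (hω₁ : IsDualizingSheaf ω₁) (hL₁ : IsInvertible L₁)
    (hω₂ : IsDualizingSheaf ω₂) (hL₂ : IsInvertible L₂)
    {i₁ : (pushforward j₁).obj (tensor ω₁ L₁) ⟶ structureSheaf Y} {w₁ : i₁ ≫ structureMap j₂ = 0}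
    (h₁ : (ShortComplex.mk i₁ (structureMap j₂) w₁).ShortExact)
    {i₂ : (pushforward j₂).obj (tensor ω₂ L₂) ⟶ structureSheaf Y} {w₂ : i₂ ≫ structureMap j₁ = 0}
    (h₂ : (ShortComplex.mk i₂ (structureMap j₁) w₂).ShortExact)
    {x₁ : X₁} {x₂ : X₂} {y : Y} (e₁ : j₁ x₁ = y) (e₂ : j₂ x₂ = y)
    (hCM₁ : IsCohenMacaulayLocal (X₁.presheaf.stalk x₁))
    (hCM₂ : IsCohenMacaulayLocal (X₂.presheaf.stalk x₂)) :
    IsGorensteinLocal (Y.presheaf.stalk y) := by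
  obtain ⟨β₁, hβ₁, hsmul₁, hrange₁⟩ := exists_dualizing_to_stalk hL₁ h₁ e₁
  obtain ⟨β₂, hβ₂, hsmul₂, hrange₂⟩ := exists_dualizing_to_stalk hL₂ h₂ e₂
  refine isGorensteinLocal_of_doubleExtension_ringHom (stalkHom_surjective j₁ e₁)
    (stalkHom_surjective j₂ e₂) hβ₁ hβ₂ hsmul₁ hsmul₂ (fun a ↦ ?_) (fun a ↦ ?_) hCM₁ hCM₂
    (hω₁.2 x₁) (hω₂.2 x₂)
  · rw [← mem_kernelStalk_iff j₂ e₂, hrange₁]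
  · rw [← mem_kernelStalk_iff j₁ e₁, hrange₂]

end Points

end LinkageExt


theorem mainTheorem2 (X₁ X₂ Y : Scheme.{u}) [IsLocallyNoetherian Y]
    (hCM₁ : LinkageExt.IsLocallyCohenMacaulay X₁) (hCM₂ : LinkageExt.IsLocallyCohenMacaulay X₂)
    (hE₁ : LinkageExt.IsEquidimensional X₁) (hE₂ : LinkageExt.IsEquidimensional X₂)
    (hdim : topologicalKrullDim X₁ = topologicalKrullDim X₂)
    (hY : LinkageExt.IsLinkageExtension X₁ X₂ Y) :
    LinkageExt.IsLocallyGorenstein Y := by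
  obtain ⟨j₁, j₂, ω₁, L₁, ω₂, L₂, hω₁, hω₂, hL₁, hL₂, ⟨D⟩⟩ := hY
  have := D.isClosedImmersion₁
  have := D.isClosedImmersion₂
  refine ⟨inferInstance, fun y ↦ ?_⟩
  by_cases hy₁ : y ∈ Set.range j₁
  · obtain ⟨x₁, rfl⟩ := hy₁
    by_cases hy₂ : j₁ x₁ ∈ Set.range j₂
    · obtain ⟨x₂, hx₂⟩ := hy₂
      exact LinkageExt.isGorensteinLocal_stalk_of_mem hω₁ hL₁ hω₂ hL₂ D.exact₁ D.exact₂ rfl hx₂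
        (hCM₁.2 x₁) (hCM₂.2 x₂)
    · exact LinkageExt.isGorensteinLocal_stalk_of_notMem hω₁ hL₁ D.exact₁ D.exact₂ x₁ hy₂
  · by_cases hy₂ : y ∈ Set.range j₂
    · obtain ⟨x₂, rfl⟩ := hy₂
      exact LinkageExt.isGorensteinLocal_stalk_of_notMem hω₂ hL₂ D.exact₂ D.exact₁ x₂ hy₁
    · -- outside both subschemes the kernel of `𝒪_Y ⟶ j₂_* 𝒪_{X₂}` has stalk both `𝒪_{Y,y}` and `0`
      have h := LinkageExt.kernelStalk_eq_zero D.exact₁ hy₁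
      rw [LinkageExt.kernelStalk_eq_univ j₂ hy₂] at h
      exact absurd (h (Set.mem_univ 1)) one_ne_zero
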